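/- Let $a>0$, $q\in(0,2)$, $\nu=\nu_1+i\nu_2$ and $\alpha=\alpha_1+i\alpha_2$ with $\nu_1>0$, $\alpha_1\ge 0$, $\nu_2,\alpha_2\in\mathbb R$. Let $H=L^2(\mathbb R;\mathbb C)$ with the real scalar product $\langle u,v\rangle=\mathrm{Re}\int_{\mathbb R}u\bar v\,dx$ and norm $\|\cdot\|$, let $\|f\|_{H^1}^2=\|f\|^2+\|\partial_xf\|^2$, and let $$\varphi(x)=\log(x^2+2),\qquad \psi(t,x)=\varphi(x)\bigl(1-e^{-t/\varphi(x)}\bigr).$$ There is a constant $C>0$ depending only on $a,\nu,\alpha,q$ such that the following holds. Let $\{e_j\}_{j\ge1}$ be an orthonormal basis of $H$ with $e_j\in H^1(\mathbb R;\mathbb C)$ for all $j$, and let $\mathsf P_N$ be the orthogonal projection in $H$ onto $\mathrm{span}\{e_1,\dots,e_N\}$, extended to $g\in H^{-1}$ by $\mathsf P_Ng=\sum_{j\le N}\langle g,e_j\rangle e_j$. Then for any $\varepsilon>0$ there are a time $T>0$ and an integer $N\ge1$ such that the following is true for every $h\in H$, every real sequence $(b_j)$ with $\sum_jb_j^2<\infty$,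 every sequence $(\beta_j)$ of independent standard real Brownian motions on a filtered probability space satisfying the usual conditions, and every $u_0,u_0'\in H$. Let $\eta=\partial_t\sum_jb_j\beta_j(t)e_j$, and let $u$ and $v$ be solutions (adapted, with paths almost surely in $C([0,\infty);H)\cap L^2_{\rm loc}([0,\infty);H^1)$, the equations being understood weakly in $x$ and integrated in $t$) of $$\partial_tu+au-\nu\partial_{xx}u+\alpha|u|^qu=h+\eta,\qquad u(0)=u_0,$$ $$\partial_tv+av-\nu\partial_{xx}v+\alpha|v|^qv+\mathsf P_N\bigl[\alpha|u|^qu-\alpha|v|^qv-\nu\partial_{xx}(u-v)\bigr]=h+\eta,\qquad v(0)=u_0'.$$ Then, almost surely, $w=u-v$ satisfies, for all $t\ge s\ge0$, $$\|w(t+T)\|^2\le\Bigl(\|w(s+T)\|^2+\frac{|\nu|^2}{a\nu_1}\|\partial_x\mathsf P_Nw(s+T)\|^2\Bigr)\exp\Bigl(-a(t-s)+C\varepsilon\int_{s+T}^{t+T}\bigl(\|u\|_{H^1}^2+\|\psi u\|_{H^1}^2+\|v\|_{H^1}^2+\|\psi v\|_{H^1}^2\bigr)\,dr\Bigr),$$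 where the integral on the right-hand side is finite. -/

import Mathlib

open MeasureTheory ProbabilityTheory
open scoped NNReal ENNReal ComplexConjugate

noncomputable section

namespace CGL

/-- The space `H = L²(ℝ; ℂ)`. It is used as a real Hilbert space: the scalar product is
`inner ℝ u v = Re ∫ u(x) conj (v(x)) dx`. -/
abbrev H : Type := Lp ℂ 2 (volume : Measure ℝ)

/-- `g` is the weak (distributional) derivative of `f` on the real line. -/
def HasWeakDeriv (f g : H) : Prop :=
  ∀ θ : ℝ → ℝ, ContDiff ℝ (⊤ : ℕ∞) θ → HasCompactSupport θ →
    ∫ x, deriv θ x • f x = - ∫ x, θ x • g x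

/-- Membership in the Sobolev space `H¹(ℝ; ℂ)`. -/
def MemH1 (f : H) : Prop := ∃ g : H, HasWeakDeriv f g

open Classical in
/-- The weak derivative `∂ₓ f ∈ L²` of `f ∈ H¹` (and `0` by convention when `f ∉ H¹`). -/
def dx (f : H) : H := if hf : MemH1 f then hf.choose else 0

open Classical in
/-- The squared `H¹`-norm `‖f‖² + ‖∂ₓ f‖²`, equal to `∞` when `f ∉ H¹`. -/
def h1NormSq (f : H) : ℝ≥0∞ := if MemH1 f then ‖f‖ₑ ^ 2 + ‖dx f‖ₑ ^ 2 else ⊤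

/-! The space-time weight. -/

/-- `φ(x) = log (x² + 2)`. -/
def phi (x : ℝ) : ℝ := Real.log (x ^ 2 + 2)

/-- `ψ(t, x) = φ(x) (1 - exp (-t / φ(x)))`. -/
def psi (t x : ℝ) : ℝ := phi x * (1 - Real.exp (-t / phi x))

theorem phi_pos (x : ℝ) : 0 < phi x := Real.log_pos (by nlinarith [sq_nonneg x])

theorem continuous_psi (t : ℝ) : Continuous (psi t) := by
  have h1 : Continuous phi := by
    unfold phi
    exact Continuous.log (by fun_prop) (fun x => by positivity)
  unfold psi
  exact h1.mul (continuous_const.sub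
    (Real.continuous_exp.comp (continuous_const.div h1 (fun x => (phi_pos x).ne'))))

theorem abs_psi_le {t : ℝ} (ht : 0 ≤ t) (x : ℝ) : |psi t x| ≤ t := by
  have hp := phi_pos x
  have h1 : Real.exp (-t / phi x) ≤ 1 := by
    rw [Real.exp_le_one_iff]
    exact div_nonpos_of_nonpos_of_nonneg (by linarith) hp.le
  have h2 := Real.add_one_le_exp (-t / phi x)
  rw [psi, abs_of_nonneg (mul_nonneg hp.le (by linarith))]
  have h3 : phi x * (1 - Real.exp (-t / phi x)) ≤ phi x * (t / phi x) := by
    apply mul_le_mul_of_nonneg_left _ hp.le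
    rw [neg_div] at h2 ⊢
    linarith
  rwa [mul_div_cancel₀ _ hp.ne'] at h3

/-- Multiplication by the bounded function `ψ(t, ·)` maps `H` to itself. -/
theorem memLp_psi_mul (t : ℝ≥0) (f : H) :
    MemLp (fun x => (psi t x : ℂ) * f x) 2 (volume : Measure ℝ) := by
  refine MemLp.of_le_mul (c := (t : ℝ)) (Lp.memLp f) ?_ ?_
  · exact (Complex.continuous_ofReal.comp (continuous_psi t)).aestronglyMeasurable.mul
      (Lp.memLp f).aestronglyMeasurable
  · refine Filter.Eventually.of_forall fun x => ?_
    rw [norm_mul, Complex.norm_real, Real.norm_eq_abs]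
    exact mul_le_mul_of_nonneg_right (abs_psi_le t.2 x) (norm_nonneg _)

/-- The element `ψ(t, ·) f` of `H`. -/
def psiMul (t : ℝ≥0) (f : H) : H := (memLp_psi_mul t f).toLp _

/-! The equations. -/

/-- The orthogonal projection of `w` onto the (real) span of the first `N` basis vectors. -/
def proj (e : HilbertBasis ℕ ℝ H) (N : ℕ) (w : H) : H :=
  ∑ j ∈ Finset.range N, inner ℝ (e j) w • e j

/-- The value at `f ∈ H¹` of the functional `α |u|^q u - ν ∂ₓₓ u ∈ H⁻¹`, for `u ∈ H¹`; that is
`⟨α |u|^q u, f⟩ + ⟨ν ∂ₓ u, ∂ₓ f⟩`. -/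
def pairing (q : ℝ) (ν α : ℂ) (u f : H) : ℝ :=
  (∫ x, α * ((‖u x‖ ^ q : ℝ) : ℂ) * u x * conj (f x)).re + inner ℝ (ν • dx u) (dx f)

/-- The value at `f` of the feedback `P_N [α |u|^q u - α |v|^q v - ν ∂ₓₓ (u - v)]`; the projection
of `g ∈ H⁻¹` is `P_N g = ∑_{j ≤ N} ⟨g, e_j⟩ e_j`. -/
def feedback (q : ℝ) (ν α : ℂ) (e : HilbertBasis ℕ ℝ H) (N : ℕ) (u v f : H) : ℝ :=
  ∑ j ∈ Finset.range N,
    (pairing q ν α u (e j) - pairing q ν α v (e j)) * inner ℝ (e j) f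

/-- Paths in `C([0, ∞); H) ∩ L²_loc([0, ∞); H¹)`. -/
structure IsEnergyPath (U : ℝ≥0 → H) : Prop where
  continuous : Continuous U
  memH1 : ∀ᵐ r ∂(volume.restrict (Set.Ioi (0 : ℝ))), MemH1 (U r.toNNReal)
  memLp_dx : ∀ t : ℝ≥0,
    MemLp (fun r : ℝ => dx (U r.toNNReal)) 2 (volume.restrict (Set.Ioc (0 : ℝ) t))

/-- Weak form, tested with all `f ∈ H¹` and integrated in time, of the equation
`dU + A(t) dt = h dt + dW`, `U(0) = x₀`, where `A t f` is the value of `A(t) ∈ H⁻¹` at `f`. -/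
def WeakForm (h x₀ : H) (W U : ℝ≥0 → H) (A : ℝ≥0 → H → ℝ) : Prop :=
  ∀ f : H, MemH1 f → ∀ t : ℝ≥0,
    IntervalIntegrable (fun r : ℝ => A r.toNNReal f) volume 0 t ∧
    inner ℝ (U t) f + ∫ r in (0 : ℝ)..t, A r.toNNReal f =
      inner ℝ x₀ f + t * inner ℝ h f + inner ℝ (W t) f

section Stochastic

variable {Ω : Type*} [mΩ : MeasurableSpace Ω]

/-- The usual conditions: the filtration is right-continuous and `𝓕 0` contains all `P`-null sets
(so that `P` is complete). -/
structure UsualConditions (P : Measure Ω) (𝓕 : Filtration ℝ≥0 mΩ) : Prop where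
  rightContinuous : 𝓕.IsRightContinuous
  complete : ∀ s : Set Ω, P s = 0 → MeasurableSet[𝓕 0] s

/-- `β 0, β 1, …` are independent standard real Brownian motions with respect to `𝓕`. -/
structure IsBrownianFamily (P : Measure Ω) (𝓕 : Filtration ℝ≥0 mΩ) (β : ℕ → ℝ≥0 → Ω → ℝ) :
    Prop where
  brownian : ∀ j, IsBrownianReal (β j) P
  adapted : ∀ j, StronglyAdapted 𝓕 (β j)
  indep_past : ∀ j, ∀ s t : ℝ≥0, s ≤ t →
    Indep (MeasurableSpace.comap (fun ω => β j t ω - β j s ω) inferInstance) (𝓕 s) P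
  indep : iIndepFun (fun j ω t => β j t ω) P

/-- The `H`-valued process `W(t) = ∑_j b_j β_j(t) e_j`, whose time derivative is the noise `η`.
When `∑ b_j² < ∞`, almost surely the series converges in `H` for all `t`. -/
def noise (b : ℕ → ℝ) (e : HilbertBasis ℕ ℝ H) (β : ℕ → ℝ≥0 → Ω → ℝ) (t : ℝ≥0) (ω : Ω) : H :=
  ∑' j, (b j * β j t ω) • e j

/-- `u` is the solution, with driving process `W` and initial value `u₀`, of
`∂ₜ u + a u - ν ∂ₓₓ u + α |u|^q u = h + ∂ₜ W`. -/
structure IsCGLSolution (P : Measure Ω) (𝓕 : Filtration ℝ≥0 mΩ) (a q : ℝ) (ν α : ℂ) (h : H)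
    (W : ℝ≥0 → Ω → H) (u₀ : H) (u : ℝ≥0 → Ω → H) : Prop where
  adapted : StronglyAdapted 𝓕 u
  path : ∀ᵐ ω ∂P, IsEnergyPath (fun t => u t ω)
  weak : ∀ᵐ ω ∂P, WeakForm h u₀ (fun t => W t ω) (fun t => u t ω)
    (fun t f => a * inner ℝ (u t ω) f + pairing q ν α (u t ω) f)

/-- `v` is the solution, for the given process `u`, of the equation with feedback
`∂ₜ v + a v - ν ∂ₓₓ v + α |v|^q v + P_N [α |u|^q u - α |v|^q v - ν ∂ₓₓ (u - v)] = h + ∂ₜ W`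
with initial value `v₀`. -/
structure IsFeedbackSolution (P : Measure Ω) (𝓕 : Filtration ℝ≥0 mΩ) (a q : ℝ) (ν α : ℂ) (h : H)
    (W : ℝ≥0 → Ω → H) (e : HilbertBasis ℕ ℝ H) (N : ℕ) (u : ℝ≥0 → Ω → H) (v₀ : H)
    (v : ℝ≥0 → Ω → H) : Prop where
  adapted : StronglyAdapted 𝓕 v
  path : ∀ᵐ ω ∂P, IsEnergyPath (fun t => v t ω)
  weak : ∀ᵐ ω ∂P, WeakForm h v₀ (fun t => W t ω) (fun t => v t ω)
    (fun t f => a * inner ℝ (v t ω) f + pairing q ν α (v t ω) f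
      + feedback q ν α e N (u t ω) (v t ω) f)

end Stochastic

/-- `‖u‖²_{H¹} + ‖ψ u‖²_{H¹} + ‖v‖²_{H¹} + ‖ψ v‖²_{H¹}` at time `r`. -/
def weightedEnergy (U V : ℝ≥0 → H) (r : ℝ≥0) : ℝ≥0∞ :=
  h1NormSq (U r) + h1NormSq (psiMul r (U r)) + h1NormSq (V r) + h1NormSq (psiMul r (V r))

/-- The time integral of `weightedEnergy` from `s` to `t`. -/
def weightedIntegral (U V : ℝ≥0 → H) (s t : ℝ≥0) : ℝ≥0∞ :=
  ∫⁻ r in Set.Ioc (s : ℝ) t, weightedEnergy U V r.toNNReal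

end CGL

end

/-!
The noise enters both equations in the same way, so `w = u - v` solves, path by path, the
deterministic equation `∂ₜw + a w + (1 - P_N)[g - ν ∂ₓₓw] = 0` with `g = α|u|^q u - α|v|^q v`.

*Low modes.* `p = P_N w` solves `∂ₜp + a p = 0`, so `p` and `∂ₓp` decay like `e^{-at}`
(`IsCoupledPair.proj_difference_eq`).

*High modes.* For `z = w - p` there is an energy identity (`norm_sq_sub_norm_sq_eq`). Its term
`⟨ν ∂ₓp, ∂ₓz⟩` costs half of the dissipation `2 ν₁ ‖∂ₓz‖²` and the exponentially decaying source
`|ν|²/ν₁ ‖∂ₓp‖²` (`rate_le`). The remaining dissipation, half of the damping and a factor `ε` of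
the energy have to absorb the nonlinear term, which is bounded by
`∫ (|u|^q + |v|^q) |w| |z| dx` (`exists_nonlinear_bound`). Two sources of smallness are used
(`exists_trilinear_bound`):

* for `|x| > R` and late times the weight `ψ` is large, so `u = ψ⁻¹ (ψ u)` is small in `L^∞`
  relative to the `H¹`-norm of `ψ u`;
* for `|x| ≤ R` the function `z`, being orthogonal to many basis vectors, is small in `L^∞` relative
  to its `H¹`-norm (`exists_local_bound`), and `q < 2` allows `|u|^q` to be absorbed by `ε |u|²` and
  a constant.

Grönwall's inequality, with a coefficient that is merely integrable in time
(`gronwall_of_lintegral`), then gives the claim.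
-/

namespace CGL

open Filter Topology Set

/-! ### Weak derivatives on the line -/

theorem locallyIntegrable_coe (f : H) : LocallyIntegrable (f : ℝ → ℂ) volume :=
  (Lp.memLp f).locallyIntegrable (by norm_num)

theorem integrable_smul_coe {θ : ℝ → ℝ} (hθ : Continuous θ) (hc : HasCompactSupport θ) (f : H) :
    Integrable (fun x => θ x • f x) volume :=
  (locallyIntegrable_coe f).integrable_smul_left_of_hasCompactSupport hθ hc

theorem HasWeakDeriv.unique {f g g' : H} (h : HasWeakDeriv f g) (h' : HasWeakDeriv f g') :
    g = g' := by
  refine Lp.ext ?_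
  refine ae_eq_of_integral_contDiff_smul_eq (locallyIntegrable_coe g) (locallyIntegrable_coe g') ?_
  intro θ hθ hc
  have := (h θ hθ hc).symm.trans (h' θ hθ hc)
  exact neg_injective this

theorem MemH1.hasWeakDeriv {f : H} (h : MemH1 f) : HasWeakDeriv f (dx f) := by
  rw [dx, dif_pos h]
  exact h.choose_spec

theorem HasWeakDeriv.memH1 {f g : H} (h : HasWeakDeriv f g) : MemH1 f := ⟨g, h⟩

theorem HasWeakDeriv.dx_eq {f g : H} (h : HasWeakDeriv f g) : dx f = g :=
  h.memH1.hasWeakDeriv.unique h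

theorem HasWeakDeriv.add {f g f' g' : H} (h : HasWeakDeriv f g) (h' : HasWeakDeriv f' g') :
    HasWeakDeriv (f + f') (g + g') := by
  intro θ hθ hc
  have hd : Continuous (deriv θ) := hθ.continuous_deriv (by simp)
  have e1 : ∫ x, deriv θ x • (f + f') x = ∫ x, (deriv θ x • f x + deriv θ x • f' x) := by
    refine integral_congr_ae ?_
    filter_upwards [Lp.coeFn_add f f'] with x hx
    rw [hx, Pi.add_apply, smul_add]
  have e2 : ∫ x, θ x • (g + g') x = ∫ x, (θ x • g x + θ x • g' x) := by
    refine integral_congr_ae ?_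
    filter_upwards [Lp.coeFn_add g g'] with x hx
    rw [hx, Pi.add_apply, smul_add]
  rw [e1, e2, integral_add (integrable_smul_coe hd hc.deriv f) (integrable_smul_coe hd hc.deriv f'),
    integral_add (integrable_smul_coe hθ.continuous hc g) (integrable_smul_coe hθ.continuous hc g'),
    h θ hθ hc, h' θ hθ hc, neg_add]

theorem HasWeakDeriv.smul {f g : H} (h : HasWeakDeriv f g) (c : ℝ) :
    HasWeakDeriv (c • f) (c • g) := by
  intro θ hθ hc
  have e1 : ∫ x, deriv θ x • (c • f) x = ∫ x, c • deriv θ x • f x := by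
    refine integral_congr_ae ?_
    filter_upwards [Lp.coeFn_smul c f] with x hx
    rw [hx, Pi.smul_apply, smul_comm]
  have e2 : ∫ x, θ x • (c • g) x = ∫ x, c • θ x • g x := by
    refine integral_congr_ae ?_
    filter_upwards [Lp.coeFn_smul c g] with x hx
    rw [hx, Pi.smul_apply, smul_comm]
  rw [e1, e2, integral_smul, integral_smul, h θ hθ hc, smul_neg]

theorem HasWeakDeriv.sub {f g f' g' : H} (h : HasWeakDeriv f g) (h' : HasWeakDeriv f' g') :
    HasWeakDeriv (f - f') (g - g') := by
  have := h.add (h'.smul (-1))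
  simpa [sub_eq_add_neg] using this

theorem hasWeakDeriv_zero : HasWeakDeriv (0 : H) 0 := by
  intro θ _ _
  have h0 : ∀ (F : ℝ → ℝ), ∫ x, F x • (0 : H) x = 0 := by
    intro F
    rw [← integral_zero ℝ ℂ (μ := volume)]
    refine integral_congr_ae ?_
    filter_upwards [Lp.coeFn_zero ℂ 2 (volume : Measure ℝ)] with x hx
    rw [hx]; simp
  rw [h0, h0, neg_zero]

theorem HasWeakDeriv.sum {ι : Type*} {f g : ι → H} (s : Finset ι)
    (h : ∀ i ∈ s, HasWeakDeriv (f i) (g i)) :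
    HasWeakDeriv (∑ i ∈ s, f i) (∑ i ∈ s, g i) := by
  classical
  induction s using Finset.induction_on with
  | empty => simpa using hasWeakDeriv_zero
  | insert i s hi ih =>
    rw [Finset.sum_insert hi, Finset.sum_insert hi]
    exact (h i (by simp)).add (ih fun j hj => h j (by simp [hj]))

theorem dx_sub {f g : H} (hf : MemH1 f) (hg : MemH1 g) : dx (f - g) = dx f - dx g :=
  (hf.hasWeakDeriv.sub hg.hasWeakDeriv).dx_eq

theorem MemH1.sub {f g : H} (hf : MemH1 f) (hg : MemH1 g) : MemH1 (f - g) :=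
  (hf.hasWeakDeriv.sub hg.hasWeakDeriv).memH1

theorem dx_smul {f : H} (hf : MemH1 f) (c : ℝ) : dx (c • f) = c • dx f :=
  (hf.hasWeakDeriv.smul c).dx_eq

theorem hasWeakDeriv_proj {e : HilbertBasis ℕ ℝ H} (he : ∀ j, MemH1 (e j)) (N : ℕ) (w : H) :
    HasWeakDeriv (proj e N w) (∑ j ∈ Finset.range N, inner ℝ (e j) w • dx (e j)) :=
  HasWeakDeriv.sum _ fun j _ => (he j).hasWeakDeriv.smul _

/-! ### Sobolev estimates on the line -/

theorem integrable_norm_sq (f : H) : Integrable (fun x => ‖f x‖ ^ 2) volume :=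
  (memLp_two_iff_integrable_sq_norm (Lp.aestronglyMeasurable f)).1 (Lp.memLp f)

theorem norm_sq_eq_integral (f : H) : ‖f‖ ^ 2 = ∫ x, ‖f x‖ ^ 2 := by
  rw [← real_inner_self_eq_norm_sq, L2.inner_def]
  exact integral_congr_ae (Eventually.of_forall fun x => real_inner_self_eq_norm_sq _)

/-- Cauchy–Schwarz on a set of finite measure. -/
theorem setIntegral_norm_le (f : H) {s : Set ℝ} (hf : volume s ≠ ⊤) :
    ∫ x in s, ‖f x‖ ≤ √(volume.real s) * ‖f‖ := by
  have : IsFiniteMeasure (volume.restrict s) := ⟨by simpa using hf.lt_top⟩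
  have h1 : MemLp (fun x => ‖f x‖) 2 (volume.restrict s) := ((Lp.memLp f).restrict s).norm
  have h2 : MemLp (fun _ : ℝ => (1 : ℝ)) 2 (volume.restrict s) := memLp_const 1
  have h := integral_mul_le_Lp_mul_Lq_of_nonneg (μ := volume.restrict s)
    (f := fun _ => (1 : ℝ)) (g := fun x => ‖f x‖) Real.HolderConjugate.two_two
    (Eventually.of_forall fun _ => zero_le_one) (Eventually.of_forall fun _ => norm_nonneg _)
    (by simpa using h2) (by simpa using h1)
  have h3 : ∫ x in s, ‖f x‖ ^ 2 ≤ ‖f‖ ^ 2 := by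
    rw [norm_sq_eq_integral]
    exact setIntegral_le_integral (integrable_norm_sq f)
      (Eventually.of_forall fun _ => by positivity)
  simp only [one_mul, integral_const, smul_eq_mul, one_pow, mul_one,
    ← Real.sqrt_eq_rpow, Real.rpow_ofNat] at h
  refine h.trans ?_
  have h4 : (volume.restrict s).real univ = volume.real s := by simp [Measure.real]
  rw [h4]
  refine mul_le_mul_of_nonneg_left ?_ (Real.sqrt_nonneg _)
  exact Real.sqrt_le_iff.2 ⟨norm_nonneg _, h3⟩

/-- The increments of the mollifications of `f` are bounded by the norm of the weak derivative,
uniformly in the mollifier `ρ` up to its radius. The weak derivative is tested with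
`x ↦ ∫_{-∞}^{b-x} ρ - ∫_{-∞}^{a-x} ρ`, a smooth approximation of the indicator of `[a, b]`. -/
theorem HasWeakDeriv.norm_mollify_sub_le {f g : H} (h : HasWeakDeriv f g) (ρ : ContDiffBump (0 : ℝ))
    {a b : ℝ} (hab : a ≤ b) :
    ‖(∫ x, ρ.normed volume (b - x) • f x) - ∫ x, ρ.normed volume (a - x) • f x‖
      ≤ √(b - a + 2 * ρ.rOut) * ‖g‖ := by
  set σ : ℝ → ℝ := ρ.normed volume with hσ
  set r := ρ.rOut with hr
  have hr0 : 0 < r := ρ.rOut_pos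
  have hσc : Continuous σ := ρ.continuous_normed
  have hσs : ContDiff ℝ (⊤ : ℕ∞) σ := ρ.contDiff_normed
  have hσ0 : ∀ x, r ≤ |x| → σ x = 0 := by
    intro x hx
    have : x ∉ Function.support σ := by
      rw [hσ, ρ.support_normed_eq]
      simpa [Real.norm_eq_abs] using hx
    simpa using this
  -- `p` increases from `0` to `1` across the support of the mollifier.
  set p : ℝ → ℝ := fun y => ∫ t in (-r)..y, σ t with hp
  have hpd : ∀ y, HasDerivAt p (σ y) y := fun y =>
    intervalIntegral.integral_hasDerivAt_right (hσc.intervalIntegrable _ _)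
      (hσc.stronglyMeasurableAtFilter _ _) hσc.continuousAt
  have hps : ContDiff ℝ (⊤ : ℕ∞) p := by
    rw [contDiff_infty_iff_deriv]
    refine ⟨fun y => (hpd y).differentiableAt, ?_⟩
    rw [show deriv p = σ from funext fun y => (hpd y).deriv]
    exact hσs
  have hmono : Monotone p := by
    refine monotone_of_deriv_nonneg (fun y => (hpd y).differentiableAt) fun y => ?_
    rw [(hpd y).deriv]
    exact ρ.nonneg_normed y
  have hlow : ∀ y, y ≤ -r → p y = 0 := by
    intro y hy
    refine intervalIntegral.integral_zero_ae ?_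
    refine Eventually.of_forall fun t ht => hσ0 t ?_
    rw [uIoc_of_ge hy] at ht
    rw [abs_of_nonpos (by linarith [ht.2])]
    linarith [ht.2]
  have hhigh : ∀ y, r ≤ y → p y = 1 := by
    intro y hy
    rw [← ρ.integral_normed (μ := volume)]
    refine intervalIntegral.integral_eq_integral_of_support_subset ?_
    intro t ht
    by_contra hcon
    refine ht (hσ0 t ?_)
    rw [mem_Ioc, not_and_or, not_lt, not_le] at hcon
    rcases hcon with hcon | hcon
    · rw [abs_of_nonpos (by linarith)]; linarith
    · rw [abs_of_nonneg (by linarith)]; linarith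
  have hp0 : ∀ y, 0 ≤ p y := fun y => by
    rcases le_total y (-r) with hy | hy
    · exact (hlow y hy).ge
    · rw [← hlow (-r) le_rfl]; exact hmono hy
  have hp1 : ∀ y, p y ≤ 1 := fun y => by
    rcases le_total r y with hy | hy
    · exact (hhigh y hy).le
    · rw [← hhigh r le_rfl]; exact hmono hy
  set θ : ℝ → ℝ := fun x => p (b - x) - p (a - x) with hθ
  have hθs : ContDiff ℝ (⊤ : ℕ∞) θ :=
    (hps.comp (contDiff_const.sub contDiff_id)).sub (hps.comp (contDiff_const.sub contDiff_id))
  have hθ0 : ∀ x, x ∉ Icc (a - r) (b + r) → θ x = 0 := by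
    intro x hx
    rw [mem_Icc, not_and_or, not_le, not_le] at hx
    rcases hx with hx | hx
    · simp only [hθ]
      rw [hhigh _ (by linarith), hhigh _ (by linarith), sub_self]
    · simp only [hθ]
      rw [hlow _ (by linarith), hlow _ (by linarith), sub_self]
  have hθc : HasCompactSupport θ := HasCompactSupport.intro isCompact_Icc fun x hx => hθ0 x hx
  have hθd : ∀ x, deriv θ x = σ (a - x) - σ (b - x) := by
    intro x
    have h1 : HasDerivAt (fun x => p (b - x)) (σ (b - x) * (-1)) x :=
      (hpd (b - x)).comp x ((hasDerivAt_id x).const_sub b)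
    have h2 : HasDerivAt (fun x => p (a - x)) (σ (a - x) * (-1)) x :=
      (hpd (a - x)).comp x ((hasDerivAt_id x).const_sub a)
    have h3 : HasDerivAt θ (σ (b - x) * (-1) - σ (a - x) * (-1)) x := h1.sub h2
    rw [h3.deriv]; ring
  have hθle : ∀ x, ‖θ x‖ ≤ 1 := by
    intro x
    have : 0 ≤ θ x := sub_nonneg.2 (hmono (by linarith))
    rw [Real.norm_eq_abs, abs_of_nonneg this]
    simp only [hθ]
    linarith [hp1 (b - x), hp0 (a - x)]
  have hint : ∀ c, Integrable (fun x => σ (c - x) • f x) volume := by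
    intro c
    refine integrable_smul_coe (θ := fun x => σ (c - x)) (by fun_prop) ?_ f
    refine HasCompactSupport.intro (K := Icc (c - r) (c + r)) isCompact_Icc fun x hx => hσ0 _ ?_
    rw [mem_Icc, not_and_or, not_le, not_le] at hx
    rcases hx with hx | hx
    · rw [abs_of_nonneg (by linarith)]; linarith
    · rw [abs_of_nonpos (by linarith)]; linarith
  have key := h θ hθs hθc
  simp_rw [hθd, sub_smul] at key
  rw [integral_sub (hint a) (hint b)] at key
  have e : (∫ x, σ (b - x) • f x) - ∫ x, σ (a - x) • f x = ∫ x, θ x • g x := by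
    rw [← neg_neg (∫ x, θ x • g x), ← key, neg_sub]
  rw [e, ← setIntegral_eq_integral_of_forall_compl_eq_zero (s := Icc (a - r) (b + r))
    (fun x hx => by rw [hθ0 x hx, zero_smul])]
  have hfin : volume (Icc (a - r) (b + r)) ≠ ⊤ := by simp
  calc ‖∫ x in Icc (a - r) (b + r), θ x • g x‖
      ≤ ∫ x in Icc (a - r) (b + r), ‖g x‖ := by
        refine norm_integral_le_of_norm_le ?_ (Eventually.of_forall fun x => ?_)
        · exact ((locallyIntegrable_coe g).integrableOn_isCompact isCompact_Icc).norm
        · rw [norm_smul]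
          exact mul_le_of_le_one_left (norm_nonneg _) (hθle x)
    _ ≤ √(volume.real (Icc (a - r) (b + r))) * ‖g‖ := setIntegral_norm_le g hfin
    _ = _ := by
        rw [Real.volume_real_Icc_of_le (by linarith)]
        congr 2; ring

/-- Off a null set, a function in `H¹` is `1/2`-Hölder with constant the norm of its weak
derivative. -/
theorem HasWeakDeriv.exists_holder {f g : H} (h : HasWeakDeriv f g) :
    ∃ s : Set ℝ, (∀ᵐ x, x ∈ s) ∧ ∀ x ∈ s, ∀ y ∈ s, ‖f x - f y‖ ≤ √|x - y| * ‖g‖ := by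
  let ρ : ℕ → ContDiffBump (0 : ℝ) := fun n =>
    { rIn := 1 / ((n : ℝ) + 1), rOut := 2 * (1 / ((n : ℝ) + 1))
      rIn_pos := by positivity
      rIn_lt_rOut := by
        have : (0 : ℝ) < 1 / ((n : ℝ) + 1) := by positivity
        linarith }
  have hρ : Tendsto (fun n => (ρ n).rOut) atTop (𝓝 0) := by
    have h2 := (tendsto_one_div_add_atTop_nhds_zero_nat (𝕜 := ℝ)).const_mul 2
    rwa [mul_zero] at h2
  have hae := ContDiffBump.ae_convolution_tendsto_right_of_locallyIntegrable (μ := volume) (K := 2)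
    hρ (Eventually.of_forall fun n => le_rfl) (locallyIntegrable_coe f)
  simp only [convolution_lsmul_swap] at hae
  refine ⟨_, hae, ?_⟩
  have main : ∀ a b : ℝ, a ≤ b →
      Tendsto (fun n => ∫ t, (ρ n).normed volume (a - t) • f t) atTop (𝓝 (f a)) →
      Tendsto (fun n => ∫ t, (ρ n).normed volume (b - t) • f t) atTop (𝓝 (f b)) →
      ‖f b - f a‖ ≤ √(b - a) * ‖g‖ := by
    intro a b hab ha hb
    refine le_of_tendsto_of_tendsto' (hb.sub ha).norm ?_
      (fun n => h.norm_mollify_sub_le (ρ n) hab)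
    have h1 : Tendsto (fun n => b - a + 2 * (ρ n).rOut) atTop (𝓝 (b - a + 2 * 0)) :=
      (hρ.const_mul 2).const_add _
    rw [mul_zero, add_zero] at h1
    exact ((Real.continuous_sqrt.tendsto _).comp h1).mul_const _
  intro x hx y hy
  rcases le_total x y with hxy | hxy
  · rw [norm_sub_rev, abs_of_nonpos (by linarith), neg_sub]
    exact main x y hxy hx hy
  · rw [abs_of_nonneg (by linarith)]
    exact main y x hxy hy hx

/-- The interpolation form `‖f‖_∞² ≤ 4 ‖f‖ (‖f‖ + ‖∂ₓf‖)` of the one-dimensional Sobolev embedding,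
from averaging the Hölder bound over an interval of length `‖f‖ / (‖f‖ + ‖∂ₓf‖)`. -/
theorem HasWeakDeriv.ae_norm_sq_le {f g : H} (h : HasWeakDeriv f g) :
    ∀ᵐ x, ‖f x‖ ^ 2 ≤ 4 * (‖f‖ * (‖f‖ + ‖g‖)) := by
  rcases eq_or_ne f 0 with rfl | hf
  · filter_upwards [Lp.coeFn_zero ℂ 2 (volume : Measure ℝ)] with x hx
    rw [hx]; simp
  have hf0 : 0 < ‖f‖ := norm_pos_iff.2 hf
  have hg0 : 0 ≤ ‖g‖ := norm_nonneg g
  obtain ⟨s, hs, hhol⟩ := h.exists_holder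
  set ℓ : ℝ := ‖f‖ / (‖f‖ + ‖g‖) with hℓ
  have hℓ0 : 0 < ℓ := by positivity
  filter_upwards [hs] with x hx
  have hfin : volume (Icc x (x + ℓ)) ≠ ⊤ := by simp
  have hvol : volume.real (Icc x (x + ℓ)) = ℓ := by
    rw [Real.volume_real_Icc_of_le (by linarith)]; ring
  have hI := ((locallyIntegrable_coe f).integrableOn_isCompact (isCompact_Icc (a := x)
    (b := x + ℓ))).norm
  have hC : ∀ c : ℝ, IntegrableOn (fun _ => c) (Icc x (x + ℓ)) := fun c => integrableOn_const hfin
  have h1 : ∫ y in Icc x (x + ℓ), ‖f x‖ ≤ ∫ y in Icc x (x + ℓ), (‖f y‖ + √ℓ * ‖g‖) := by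
    refine setIntegral_mono_ae_restrict (hC _) (hI.add (hC _)) ?_
    filter_upwards [ae_restrict_mem measurableSet_Icc, ae_restrict_of_ae hs] with y hy hys
    have h2 := hhol x hx y hys
    have h3 : √|x - y| ≤ √ℓ := by
      refine Real.sqrt_le_sqrt ?_
      rw [abs_of_nonpos (by linarith [hy.1])]
      linarith [hy.2]
    have h4 : ‖f x‖ ≤ ‖f y‖ + ‖f x - f y‖ := norm_le_insert' _ _
    have h5 : √|x - y| * ‖g‖ ≤ √ℓ * ‖g‖ := mul_le_mul_of_nonneg_right h3 (norm_nonneg _)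
    show ‖f x‖ ≤ ‖f y‖ + √ℓ * ‖g‖
    linarith
  rw [integral_add hI (hC _)] at h1
  simp only [setIntegral_const, hvol, smul_eq_mul] at h1
  have h2 := setIntegral_norm_le f hfin
  rw [hvol] at h2
  have hs0 : 0 < √ℓ := Real.sqrt_pos.2 hℓ0
  have hss : √ℓ * √ℓ = ℓ := Real.mul_self_sqrt hℓ0.le
  have h3 : √ℓ * (√ℓ * ‖f x‖) ≤ √ℓ * (‖f‖ + ℓ * ‖g‖) := by
    have : √ℓ * (√ℓ * ‖f x‖) = ℓ * ‖f x‖ := by rw [← mul_assoc, hss]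
    rw [this]; linarith
  have h4 : √ℓ * ‖f x‖ ≤ ‖f‖ + ℓ * ‖g‖ := le_of_mul_le_mul_left h3 hs0
  have h5 : ℓ * ‖g‖ ≤ ‖f‖ := by
    rw [hℓ, div_mul_eq_mul_div, div_le_iff₀ (by positivity)]
    nlinarith
  have h6 : (√ℓ * ‖f x‖) ^ 2 ≤ (2 * ‖f‖) ^ 2 := by
    refine pow_le_pow_left₀ (by positivity) (by linarith) 2
  have h7 : ℓ * ‖f x‖ ^ 2 ≤ 4 * ‖f‖ ^ 2 := by
    have : (√ℓ * ‖f x‖) ^ 2 = ℓ * ‖f x‖ ^ 2 := by rw [mul_pow, pow_two √ℓ, hss]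
    rw [← this]; linarith
  rw [hℓ, div_mul_eq_mul_div, div_le_iff₀ (by positivity)] at h7
  refine le_of_mul_le_mul_left ?_ hf0
  linarith

/-! ### Smallness of high modes on bounded sets -/

/-- The functional `⟨φ, ·⟩` is small on the orthogonal complement of the first basis vectors. -/
theorem exists_inner_le (e : HilbertBasis ℕ ℝ H) (φ : H) {η : ℝ} (hη : 0 < η) :
    ∃ N : ℕ, ∀ z : H, (∀ j < N, inner ℝ (e j) z = 0) → |inner ℝ φ z| ≤ η * ‖z‖ := by
  have h := (e.hasSum_repr φ).tendsto_sum_nat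
  obtain ⟨N, hN⟩ := (Metric.tendsto_atTop.1 h) η hη
  refine ⟨N, fun z hz => ?_⟩
  have h1 := (hN N le_rfl).le
  have h2 : inner ℝ (∑ i ∈ Finset.range N, e.repr φ i • e i) z = 0 := by
    rw [sum_inner]
    refine Finset.sum_eq_zero fun j hj => ?_
    rw [real_inner_smul_left, hz j (Finset.mem_range.1 hj), mul_zero]
  have h3 : inner ℝ φ z = inner ℝ (φ - ∑ i ∈ Finset.range N, e.repr φ i • e i) z := by
    rw [inner_sub_left, h2, sub_zero]
  rw [h3]
  refine (abs_real_inner_le_norm _ _).trans (mul_le_mul_of_nonneg_right ?_ (norm_nonneg _))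
  rwa [← dist_eq_norm, dist_comm]

/-- The integral over `s` is small on the same complements; it is split into real and imaginary part
because the basis and the orthogonality are real. -/
theorem exists_setIntegral_le (e : HilbertBasis ℕ ℝ H) {s : Set ℝ} (hs : MeasurableSet s)
    (hfin : volume s ≠ ⊤) {η : ℝ} (hη : 0 < η) :
    ∃ N : ℕ, ∀ z : H, (∀ j < N, inner ℝ (e j) z = 0) → ‖∫ x in s, z x‖ ≤ η * ‖z‖ := by
  obtain ⟨N₁, h₁⟩ := exists_inner_le e (indicatorConstLp 2 hs hfin (1 : ℂ)) (half_pos hη)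
  obtain ⟨N₂, h₂⟩ := exists_inner_le e (indicatorConstLp 2 hs hfin Complex.I) (half_pos hη)
  refine ⟨max N₁ N₂, fun z hz => ?_⟩
  have h₁ := h₁ z fun j hj => hz j (hj.trans_le (le_max_left _ _))
  have h₂ := h₂ z fun j hj => hz j (hj.trans_le (le_max_right _ _))
  rw [L2.inner_indicatorConstLp_eq_inner_setIntegral] at h₁ h₂
  have e1 : ∀ w : ℂ, inner ℝ (1 : ℂ) w = w.re := fun w => by simp [Complex.inner]
  have e2 : ∀ w : ℂ, inner ℝ Complex.I w = w.im := fun w => by simp [Complex.inner]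
  rw [e1] at h₁
  rw [e2] at h₂
  refine (Complex.norm_le_abs_re_add_abs_im _).trans ?_
  linarith

/-- On a bounded interval, functions in `H¹` orthogonal to sufficiently many basis vectors are
uniformly small relative to their `H¹`-norm: such a function is close to its averages over the
cells of a fine partition, and these averages are finitely many functionals on `H`. -/
theorem exists_local_bound (e : HilbertBasis ℕ ℝ H) (R : ℝ) {κ : ℝ} (hκ : 0 < κ) :
    ∃ N : ℕ, ∀ z : H, MemH1 z → (∀ j < N, inner ℝ (e j) z = 0) →
      ∀ᵐ x, |x| ≤ R → ‖z x‖ ≤ κ * (‖z‖ + ‖dx z‖) := by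
  -- The mesh `κ²` makes the `1/2`-Hölder oscillation over a cell at most `κ ‖∂ₓz‖`.
  set δ : ℝ := κ ^ 2 with hδ
  have hδ0 : 0 < δ := by positivity
  have hex : ∀ k : ℤ, ∃ N : ℕ, ∀ z : H, (∀ j < N, inner ℝ (e j) z = 0) →
      ‖∫ x in Ioc (k * δ) ((k + 1) * δ), z x‖ ≤ (κ * δ) * ‖z‖ := fun k =>
    exists_setIntegral_le e measurableSet_Ioc (by simp) (by positivity)
  choose n hn using hex
  set K : Finset ℤ := Finset.Icc (-⌈R / δ⌉ - 1) ⌈R / δ⌉ with hK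
  refine ⟨K.sup n, fun z hz horth => ?_⟩
  obtain ⟨s, hs, hhol⟩ := hz.hasWeakDeriv.exists_holder
  filter_upwards [hs] with x hx hxR
  set k : ℤ := ⌈x / δ⌉ - 1 with hk
  have hxl : (k : ℝ) * δ < x := by
    have := Int.ceil_lt_add_one (x / δ)
    rw [← lt_div_iff₀ hδ0, hk]; push_cast; linarith
  have hxr : x ≤ (k + 1) * δ := by
    rw [← div_le_iff₀ hδ0, hk]; push_cast
    linarith [Int.le_ceil (x / δ)]
  have hkK : k ∈ K := by
    have h1 : ⌈x / δ⌉ ≤ ⌈R / δ⌉ := Int.ceil_mono (by gcongr; exact (abs_le.1 hxR).2)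
    have h2 : -R / δ ≤ x / δ := by gcongr; exact (abs_le.1 hxR).1
    have h3 : -⌈R / δ⌉ ≤ ⌈x / δ⌉ := by
      have h4 : (-(⌈R / δ⌉ : ℤ) : ℝ) ≤ ⌈x / δ⌉ := by
        have := Int.le_ceil (R / δ)
        have := Int.le_ceil (x / δ)
        rw [neg_div] at h2
        linarith
      exact_mod_cast h4
    rw [hK, Finset.mem_Icc]
    omega
  have hint := hn k z fun j hj => horth j (hj.trans_le (Finset.le_sup hkK))
  set J : Set ℝ := Ioc (k * δ) ((k + 1) * δ) with hJ
  have hfin : volume J ≠ ⊤ := by simp [hJ]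
  have hvol : volume.real J = δ := by
    rw [hJ, Real.volume_real_Ioc_of_le (by nlinarith)]; ring
  have hzJ : IntegrableOn (fun y => z y) J :=
    ((locallyIntegrable_coe z).integrableOn_isCompact isCompact_Icc).mono_set Ioc_subset_Icc_self
  have h1 : δ • z x = (∫ y in J, z y) + ∫ y in J, (z x - z y) := by
    have hcJ : IntegrableOn (fun _ => z x) J := integrableOn_const hfin
    rw [integral_sub hcJ hzJ, setIntegral_const, hvol]
    abel
  have h2 : ‖∫ y in J, (z x - z y)‖ ≤ (κ * ‖dx z‖) * δ := by
    rw [← hvol]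
    refine norm_setIntegral_le_of_norm_le_const_ae (lt_top_iff_ne_top.2 hfin) ?_
    filter_upwards [ae_restrict_mem measurableSet_Ioc, ae_restrict_of_ae hs] with y hy hys
    refine (hhol x hx y hys).trans (mul_le_mul_of_nonneg_right ?_ (norm_nonneg _))
    rw [Real.sqrt_le_left hκ.le, ← hδ, abs_le]
    constructor <;> nlinarith [hy.1, hy.2]
  have h3 : δ * ‖z x‖ ≤ κ * δ * ‖z‖ + κ * ‖dx z‖ * δ := by
    have := congrArg norm h1
    rw [norm_smul, Real.norm_of_nonneg hδ0.le] at this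
    rw [this]
    exact (norm_add_le _ _).trans (add_le_add hint h2)
  have h4 : δ * ‖z x‖ ≤ δ * (κ * (‖z‖ + ‖dx z‖)) := by linarith
  exact le_of_mul_le_mul_left h4 hδ0

/-! ### The space-time weight -/

theorem sq_add_two_pos (x : ℝ) : 0 < x ^ 2 + 2 := by positivity

theorem contDiff_phi : ContDiff ℝ (⊤ : ℕ∞) phi :=
  ContDiff.log (by fun_prop) fun x => (sq_add_two_pos x).ne'

theorem contDiff_psi (t : ℝ) : ContDiff ℝ (⊤ : ℕ∞) (psi t) :=
  contDiff_phi.mul (contDiff_const.sub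
    ((contDiff_const.div contDiff_phi fun x => (phi_pos x).ne').exp))

/-- The spatial derivative of the weight is bounded by `1`, uniformly in time. -/
theorem abs_deriv_psi_le {t : ℝ} (ht : 0 ≤ t) (x : ℝ) : |deriv (psi t) x| ≤ 1 := by
  have hp := phi_pos x
  have h1 : HasDerivAt phi (2 * x / (x ^ 2 + 2)) x := by
    have : HasDerivAt (fun x : ℝ => x ^ 2 + 2) (2 * x) x := by
      simpa using ((hasDerivAt_id x).pow 2).add_const (2 : ℝ)
    exact this.log (sq_add_two_pos x).ne'
  set φ' := 2 * x / (x ^ 2 + 2) with hφ'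
  set s := t / phi x with hs
  have hs0 : 0 ≤ s := div_nonneg ht hp.le
  have h2 : HasDerivAt (fun x => -t / phi x) (s / phi x * φ') x := by
    have := (h1.inv hp.ne').const_mul (-t)
    refine this.congr_deriv ?_
    rw [hs]; field_simp
  have h3 : HasDerivAt (psi t)
      (φ' * (1 - Real.exp (-t / phi x) - s * Real.exp (-t / phi x))) x := by
    refine (h1.mul (h2.exp.const_sub 1)).congr_deriv ?_
    field_simp
    ring
  rw [h3.deriv, neg_div, ← hs, abs_mul]
  have h4 : |φ'| ≤ 1 := by
    rw [hφ', abs_div, abs_of_pos (sq_add_two_pos x), div_le_one (sq_add_two_pos x), abs_le]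
    constructor <;> nlinarith [sq_nonneg (x + 1), sq_nonneg (x - 1)]
  have h5 : |1 - Real.exp (-s) - s * Real.exp (-s)| ≤ 1 := by
    have e0 := Real.exp_pos (-s)
    have e1 : (1 + s) * Real.exp (-s) ≤ 1 := by
      have := Real.add_one_le_exp s
      calc (1 + s) * Real.exp (-s) ≤ Real.exp s * Real.exp (-s) := by
            apply mul_le_mul_of_nonneg_right _ e0.le; linarith
        _ = 1 := by rw [← Real.exp_add]; simp
    rw [abs_le]
    constructor <;> nlinarith [mul_nonneg hs0 e0.le]
  calc |φ'| * |1 - Real.exp (-s) - s * Real.exp (-s)| ≤ 1 * 1 :=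
        mul_le_mul h4 h5 (abs_nonneg _) zero_le_one
    _ = 1 := one_mul 1

/-- The weight is large at late times and far from the origin. -/
theorem le_psi {t x L : ℝ} (hL : 0 < L) (ht : 2 * L ≤ t) (hx : 2 * L ≤ phi x) : L ≤ psi t x := by
  have hp := phi_pos x
  have ht0 : 0 < t := by linarith
  set s := t / phi x with hs
  have hs0 : 0 < s := div_pos ht0 hp
  -- `1 - e^{-s} ≥ s / (1 + s)` bounds `ψ` below by half the harmonic mean of `φ` and `t`.
  have e1 : Real.exp (-s) ≤ 1 / (1 + s) := by
    rw [Real.exp_neg, ← one_div]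
    exact one_div_le_one_div_of_le (by linarith) (by linarith [Real.add_one_le_exp s])
  have e2 : phi x * (1 - 1 / (1 + s)) = phi x * t / (phi x + t) := by
    rw [hs]; field_simp; ring
  have e3 : L ≤ phi x * t / (phi x + t) := by
    rw [le_div_iff₀ (by linarith)]
    nlinarith [mul_le_mul_of_nonneg_left ht hp.le, mul_le_mul_of_nonneg_left hx ht0.le]
  rw [psi, neg_div, ← hs]
  calc L ≤ phi x * (1 - 1 / (1 + s)) := by rw [e2]; exact e3
    _ ≤ _ := mul_le_mul_of_nonneg_left (by linarith) hp.le

theorem exists_le_phi (M : ℝ) : ∃ R : ℝ, ∀ x, R < |x| → M ≤ phi x := by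
  refine ⟨Real.exp M, fun x hx => ?_⟩
  rw [phi, Real.le_log_iff_exp_le (sq_add_two_pos x), ← sq_abs]
  nlinarith [Real.exp_pos M, sq_nonneg (|x| - 1)]

theorem coeFn_psiMul (t : ℝ≥0) (f : H) : psiMul t f =ᵐ[volume] fun x => (psi t x : ℂ) * f x :=
  MemLp.coeFn_toLp _

theorem memLp_deriv_psi_mul (t : ℝ≥0) (f : H) :
    MemLp (fun x => ((deriv (psi t) x : ℝ) : ℂ) * f x) 2 (volume : Measure ℝ) := by
  refine MemLp.of_le_mul (c := 1) (Lp.memLp f) ?_ ?_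
  · exact (Complex.continuous_ofReal.comp
      ((contDiff_psi t).continuous_deriv (by simp))).aestronglyMeasurable.mul
      (Lp.memLp f).aestronglyMeasurable
  · refine Eventually.of_forall fun x => ?_
    rw [norm_mul, Complex.norm_real, Real.norm_eq_abs]
    exact mul_le_mul_of_nonneg_right (abs_deriv_psi_le t.2 x) (norm_nonneg _)

/-- The element `∂ₓψ(t, ·) f` of `H`. -/
noncomputable def derivPsiMul (t : ℝ≥0) (f : H) : H := (memLp_deriv_psi_mul t f).toLp _

theorem norm_psiMul_le (t : ℝ≥0) (f : H) : ‖psiMul t f‖ ≤ t * ‖f‖ := by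
  refine Lp.norm_le_mul_norm_of_ae_le_mul ?_
  filter_upwards [coeFn_psiMul t f] with x hx
  rw [hx, norm_mul, Complex.norm_real, Real.norm_eq_abs]
  exact mul_le_mul_of_nonneg_right (abs_psi_le t.2 x) (norm_nonneg _)

theorem norm_derivPsiMul_le (t : ℝ≥0) (f : H) : ‖derivPsiMul t f‖ ≤ ‖f‖ := by
  refine Lp.norm_le_norm_of_ae_le ?_
  filter_upwards [MemLp.coeFn_toLp (memLp_deriv_psi_mul t f)] with x hx
  rw [derivPsiMul, hx, norm_mul, Complex.norm_real, Real.norm_eq_abs]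
  exact mul_le_of_le_one_left (norm_nonneg _) (abs_deriv_psi_le t.2 x)

/-- The product rule `∂ₓ(ψ f) = ψ ∂ₓf + (∂ₓψ) f`. -/
theorem HasWeakDeriv.psiMul {f g : H} (h : HasWeakDeriv f g) (t : ℝ≥0) :
    HasWeakDeriv (psiMul t f) (CGL.psiMul t g + derivPsiMul t f) := by
  intro θ hθ hc
  have hψ := contDiff_psi t
  have hψ' : Continuous (deriv (psi t)) := hψ.continuous_deriv (by simp)
  have hθ' : Continuous (deriv θ) := hθ.continuous_deriv (by simp)
  have hd : ∀ x, deriv (fun x => psi t x * θ x) x = deriv (psi t) x * θ x + psi t x * deriv θ x :=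
    fun x => deriv_fun_mul (hψ.differentiable (by simp) x) (hθ.differentiable (by simp) x)
  have key := h (fun x => psi t x * θ x) (hψ.mul hθ) hc.mul_left
  simp_rw [hd, add_smul] at key
  have i1 : Integrable (fun x => (deriv (psi t) x * θ x) • f x) volume :=
    integrable_smul_coe (hψ'.mul hθ.continuous) hc.mul_left f
  have i2 : Integrable (fun x => (psi t x * deriv θ x) • f x) volume :=
    integrable_smul_coe (hψ.continuous.mul hθ') hc.deriv.mul_left f
  have i3 : Integrable (fun x => (psi t x * θ x) • g x) volume :=
    integrable_smul_coe (hψ.continuous.mul hθ.continuous) hc.mul_left g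
  rw [integral_add i1 i2] at key
  have e1 : ∫ x, deriv θ x • CGL.psiMul t f x = ∫ x, (psi t x * deriv θ x) • f x := by
    refine integral_congr_ae ?_
    filter_upwards [coeFn_psiMul t f] with x hx
    rw [hx, Complex.real_smul, Complex.real_smul]; push_cast; ring
  have e2 : ∫ x, θ x • (CGL.psiMul t g + derivPsiMul t f : H) x
      = ∫ x, ((psi t x * θ x) • g x + (deriv (psi t) x * θ x) • f x) := by
    refine integral_congr_ae ?_
    filter_upwards [coeFn_psiMul t g, MemLp.coeFn_toLp (memLp_deriv_psi_mul t f),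
      Lp.coeFn_add (CGL.psiMul t g) (derivPsiMul t f)] with x hx hx' hx''
    rw [hx'', Pi.add_apply, hx, derivPsiMul, hx']
    simp only [Complex.real_smul]; push_cast; ring
  rw [e1, e2, integral_add i3 i1, neg_add, ← key]
  abel

theorem MemH1.psiMul {f : H} (h : MemH1 f) (t : ℝ≥0) : MemH1 (CGL.psiMul t f) :=
  (h.hasWeakDeriv.psiMul t).memH1

theorem MemH1.norm_dx_psiMul_le {f : H} (h : MemH1 f) (t : ℝ≥0) :
    ‖dx (CGL.psiMul t f)‖ ≤ t * ‖dx f‖ + ‖f‖ := by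
  rw [(h.hasWeakDeriv.psiMul t).dx_eq]
  exact (norm_add_le _ _).trans (add_le_add (norm_psiMul_le t _) (norm_derivPsiMul_le t f))

/-! ### The power nonlinearity -/

theorem rpow_le_one_add_sq {y q : ℝ} (hy : 0 ≤ y) (hq₀ : 0 ≤ q) (hq₂ : q ≤ 2) :
    y ^ q ≤ 1 + y ^ 2 := by
  rcases le_total y 1 with h | h
  · have := Real.rpow_le_one hy h hq₀
    nlinarith [sq_nonneg y]
  · have := Real.rpow_le_rpow_of_exponent_le h hq₂
    rw [Real.rpow_two] at this
    linarith

/-- Monotonicity of `s ↦ s^q` in the exponent, for `s = b / a ≤ 1`, reduces this to `q = 2`. -/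
theorem mul_rpow_sub_rpow_le {a b q : ℝ} (hb : 0 ≤ b) (hba : b ≤ a) (hq₂ : q ≤ 2) :
    b * (a ^ q - b ^ q) ≤ 2 * a ^ q * (a - b) := by
  have haq : 0 ≤ a ^ q := Real.rpow_nonneg (hb.trans hba) q
  rcases hb.eq_or_lt with rfl | hb
  · nlinarith
  have ha : 0 < a := hb.trans_le hba
  set s := b / a with hs
  have hs0 : 0 < s := div_pos hb ha
  have hs1 : s ≤ 1 := (div_le_one ha).2 hba
  have hbs : b = a * s := by rw [hs]; field_simp
  have h1 : s ^ 2 ≤ s ^ q := by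
    have := Real.rpow_le_rpow_of_exponent_ge hs0 hs1 hq₂
    rwa [Real.rpow_two] at this
  have h2 : b ^ q = a ^ q * s ^ q := by rw [hbs, Real.mul_rpow ha.le hs0.le]
  rw [h2, hbs]
  have h3 : a * s * (a ^ q * (1 - s ^ q)) ≤ a * s * (a ^ q * (1 - s ^ 2)) := by gcongr
  have h4 : 0 ≤ a * a ^ q * (1 - s) * (2 - s * (1 + s)) := by
    have : 0 ≤ 2 - s * (1 + s) := by nlinarith
    have : 0 ≤ 1 - s := by linarith
    positivity
  nlinarith

/-- The function `z ↦ |z|^q z` with its factor `|z|^q` truncated at the level `M^q`. -/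
noncomputable def truncPow (q M : ℝ) (z : ℂ) : ℂ := (min ‖z‖ M ^ q : ℝ) • z

theorem truncPow_of_le {q M : ℝ} {z : ℂ} (h : ‖z‖ ≤ M) : truncPow q M z = (‖z‖ ^ q : ℝ) • z := by
  rw [truncPow, min_eq_left h]

theorem norm_truncPow_sub_le_of_le {q M : ℝ} (hq₀ : 0 ≤ q) (hq₂ : q ≤ 2) (hM : 0 ≤ M) {u v : ℂ}
    (h : ‖v‖ ≤ ‖u‖) :
    ‖truncPow q M u - truncPow q M v‖ ≤ 3 * min ‖u‖ M ^ q * ‖u - v‖ := by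
  set A := min ‖u‖ M with hA
  set B := min ‖v‖ M with hB
  have hB0 : 0 ≤ B := le_min (norm_nonneg _) hM
  have hBA : B ≤ A := min_le_min_right M h
  have hAq : 0 ≤ A ^ q := Real.rpow_nonneg (hB0.trans hBA) q
  have hBAq : B ^ q ≤ A ^ q := Real.rpow_le_rpow hB0 hBA hq₀
  have e : truncPow q M u - truncPow q M v = (A ^ q) • (u - v) + (A ^ q - B ^ q) • v := by
    simp only [truncPow, ← hA, ← hB]
    rw [smul_sub, sub_smul]; abel
  have h1 : (A ^ q - B ^ q) * ‖v‖ ≤ 2 * A ^ q * ‖u - v‖ := by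
    rcases le_total M ‖v‖ with hv | hv
    · have : A = B := by rw [hA, hB, min_eq_right hv, min_eq_right (hv.trans h)]
      rw [this, sub_self, zero_mul]
      exact mul_nonneg (mul_nonneg zero_le_two (this ▸ hAq)) (norm_nonneg _)
    · have hBv : B = ‖v‖ := min_eq_left hv
      have h2 := mul_rpow_sub_rpow_le hB0 hBA hq₂
      have h3 : A - B ≤ ‖u - v‖ := by
        have h4 : A ≤ ‖u‖ := min_le_left _ _
        have h5 := norm_sub_norm_le u v
        linarith
      calc (A ^ q - B ^ q) * ‖v‖ = B * (A ^ q - B ^ q) := by rw [hBv]; ring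
        _ ≤ 2 * A ^ q * (A - B) := h2
        _ ≤ _ := by gcongr
  rw [e]
  refine (norm_add_le _ _).trans ?_
  rw [norm_smul, norm_smul, Real.norm_of_nonneg hAq, Real.norm_of_nonneg (sub_nonneg.2 hBAq)]
  linarith

theorem lipschitzWith_truncPow {q M : ℝ} (hq₀ : 0 ≤ q) (hq₂ : q ≤ 2) (hM : 0 ≤ M) :
    LipschitzWith (Real.toNNReal (3 * M ^ q)) (truncPow q M) := by
  refine LipschitzWith.of_dist_le_mul fun u v => ?_
  rw [Real.coe_toNNReal _ (by positivity), dist_eq_norm, dist_eq_norm]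
  have key : ∀ u v : ℂ, ‖v‖ ≤ ‖u‖ → ‖truncPow q M u - truncPow q M v‖ ≤ 3 * M ^ q * ‖u - v‖ := by
    intro u v h
    refine (norm_truncPow_sub_le_of_le hq₀ hq₂ hM h).trans ?_
    gcongr
    exact min_le_right _ _
  rcases le_total ‖v‖ ‖u‖ with h | h
  · exact key u v h
  · rw [norm_sub_rev, norm_sub_rev u v]; exact key v u h

theorem truncPow_zero (q M : ℝ) : truncPow q M 0 = 0 := by simp [truncPow]

/-- The local Lipschitz bound for `z ↦ |z|^q z`. -/
theorem norm_pow_smul_sub_le {q : ℝ} (hq₀ : 0 ≤ q) (hq₂ : q ≤ 2) (u v : ℂ) :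
    ‖(‖u‖ ^ q : ℝ) • u - (‖v‖ ^ q : ℝ) • v‖ ≤ 3 * (‖u‖ ^ q + ‖v‖ ^ q) * ‖u - v‖ := by
  have key : ∀ u v : ℂ, ‖v‖ ≤ ‖u‖ →
      ‖(‖u‖ ^ q : ℝ) • u - (‖v‖ ^ q : ℝ) • v‖ ≤ 3 * (‖u‖ ^ q + ‖v‖ ^ q) * ‖u - v‖ := by
    intro u v h
    have h1 := norm_truncPow_sub_le_of_le hq₀ hq₂ (norm_nonneg u) h
    rw [truncPow_of_le le_rfl, truncPow_of_le h, min_self] at h1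
    refine h1.trans ?_
    have : 0 ≤ ‖v‖ ^ q := by positivity
    gcongr
    linarith
  rcases le_total ‖v‖ ‖u‖ with h | h
  · exact key u v h
  · rw [norm_sub_rev, norm_sub_rev u v, add_comm]; exact key v u h

/-- The `L^∞` bound `2 (‖f‖ (‖f‖ + ‖∂ₓf‖))^{1/2}` for `f ∈ H¹`. -/
noncomputable def supBound (f : H) : ℝ := 2 * √(‖f‖ * (‖f‖ + ‖dx f‖))

theorem supBound_nonneg (f : H) : 0 ≤ supBound f := by unfold supBound; positivity

theorem supBound_sq (f : H) : supBound f ^ 2 = 4 * (‖f‖ * (‖f‖ + ‖dx f‖)) := by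
  rw [supBound, mul_pow, Real.sq_sqrt (by positivity)]; norm_num

theorem MemH1.ae_norm_le {f : H} (h : MemH1 f) : ∀ᵐ x, ‖f x‖ ≤ supBound f := by
  filter_upwards [h.hasWeakDeriv.ae_norm_sq_le] with x hx
  rw [← supBound_sq] at hx
  exact le_of_sq_le_sq hx (supBound_nonneg f)

theorem supBound_sq_le (f : H) : supBound f ^ 2 ≤ 6 * (‖f‖ ^ 2 + ‖dx f‖ ^ 2) := by
  rw [supBound_sq]
  nlinarith [sq_nonneg (‖f‖ - ‖dx f‖), sq_nonneg ‖dx f‖]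

theorem norm_pow_smul_le {q y : ℝ} (hq₀ : 0 ≤ q) {z : ℂ} (h : ‖z‖ ≤ y) :
    ‖(‖z‖ ^ q : ℝ) • z‖ ≤ y ^ q * ‖z‖ := by
  rw [norm_smul, Real.norm_of_nonneg (by positivity)]
  gcongr

theorem MemH1.memLp_pow {f : H} (h : MemH1 f) {q : ℝ} (hq₀ : 0 ≤ q) :
    MemLp (fun x => (‖f x‖ ^ q : ℝ) • f x) 2 (volume : Measure ℝ) := by
  refine MemLp.of_le_mul (c := supBound f ^ q) (Lp.memLp f) ?_ ?_
  · have h1 : AEMeasurable (fun x => ‖f x‖ ^ q) volume :=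
      (Lp.aestronglyMeasurable f).norm.aemeasurable.pow_const q
    exact h1.aestronglyMeasurable.smul (Lp.aestronglyMeasurable f)
  · filter_upwards [h.ae_norm_le] with x hx
    exact norm_pow_smul_le hq₀ hx

open Classical in
/-- The nonlinearity `|f|^q f` as an element of `H`, set to `0` when this function is not in `H`
(it is in `H` for `f ∈ H¹`). -/
noncomputable def powMul (q : ℝ) (f : H) : H :=
  if h : MemLp (fun x => (‖f x‖ ^ q : ℝ) • f x) 2 (volume : Measure ℝ) then h.toLp _ else 0

theorem MemH1.coeFn_powMul {f : H} (h : MemH1 f) {q : ℝ} (hq₀ : 0 ≤ q) :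
    powMul q f =ᵐ[volume] fun x => (‖f x‖ ^ q : ℝ) • f x := by
  rw [powMul, dif_pos (h.memLp_pow hq₀)]
  exact MemLp.coeFn_toLp _

/-- By the interpolated sup bound the right-hand side is only linear in `‖∂ₓf‖`, so that the
nonlinearity is square integrable in time along paths in `L²_loc([0, ∞); H¹)`. -/
theorem MemH1.norm_powMul_le {f : H} (h : MemH1 f) {q : ℝ} (hq₀ : 0 ≤ q) (hq₂ : q ≤ 2) :
    ‖powMul q f‖ ≤ (1 + 4 * (‖f‖ * (‖f‖ + ‖dx f‖))) * ‖f‖ := by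
  have h1 : ‖powMul q f‖ ≤ supBound f ^ q * ‖f‖ := by
    refine Lp.norm_le_mul_norm_of_ae_le_mul ?_
    filter_upwards [h.coeFn_powMul hq₀, h.ae_norm_le] with x hx hx'
    rw [hx]
    exact norm_pow_smul_le hq₀ hx'
  refine h1.trans ?_
  gcongr
  rw [← supBound_sq]
  exact rpow_le_one_add_sq (supBound_nonneg f) hq₀ hq₂

/-- Along a path that is continuous in `H` and almost everywhere in `H¹`, the nonlinearity is
measurable in time, as a limit of its truncations, which are Lipschitz on `H`. -/
theorem aestronglyMeasurable_powMul {q : ℝ} (hq₀ : 0 ≤ q) (hq₂ : q ≤ 2) {U : ℝ → H}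
    (hU : Continuous U) {μ : Measure ℝ} (h : ∀ᵐ r ∂μ, MemH1 (U r)) :
    AEStronglyMeasurable (fun r => powMul q (U r)) μ := by
  have hlip := fun n : ℕ => lipschitzWith_truncPow hq₀ hq₂ (Nat.cast_nonneg (α := ℝ) n)
  refine aestronglyMeasurable_of_tendsto_ae atTop
    (f := fun (n : ℕ) r => (hlip n).compLp (truncPow_zero q n) (U r)) (fun n => ?_) ?_
  · exact (((hlip n).continuous_compLp (truncPow_zero q n)).comp hU).aestronglyMeasurable
  · filter_upwards [h] with r hr
    refine tendsto_const_nhds.congr' ?_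
    filter_upwards [eventually_ge_atTop ⌈supBound (U r)⌉₊] with n hn
    refine Lp.ext ?_
    filter_upwards [hr.coeFn_powMul hq₀, hr.ae_norm_le,
      (hlip n).coeFn_compLp (truncPow_zero q n) (U r)] with x hx hx' hx''
    rw [hx, hx'', Function.comp_apply, truncPow_of_le]
    exact hx'.trans ((Nat.le_ceil _).trans (by exact_mod_cast hn))

/-- On `H¹` the functional `pairing` is given by scalar products in `H`. -/
theorem MemH1.pairing_eq {u : H} (h : MemH1 u) {q : ℝ} (hq₀ : 0 ≤ q) (ν α : ℂ) (f : H) :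
    pairing q ν α u f = inner ℝ (α • powMul q u) f + inner ℝ (ν • dx u) (dx f) := by
  rw [pairing, L2.inner_def (𝕜 := ℝ) (α • powMul q u) f]
  congr 1
  have e : ∫ x, α * ((‖u x‖ ^ q : ℝ) : ℂ) * u x * conj (f x)
      = ∫ x, inner ℂ (f x) ((α • powMul q u : H) x) := by
    refine integral_congr_ae ?_
    filter_upwards [h.coeFn_powMul hq₀, Lp.coeFn_smul α (powMul q u)] with x hx hx'
    rw [hx', Pi.smul_apply, hx, RCLike.inner_apply, Complex.real_smul, smul_eq_mul]
    ring
  have e2 := integral_re (𝕜 := ℂ) (L2.integrable_inner (𝕜 := ℂ) f (α • powMul q u))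
  rw [e]
  refine e2.symm.trans ?_
  refine integral_congr_ae (Eventually.of_forall fun x => ?_)
  change RCLike.re (inner ℂ (f x) ((α • powMul q u : H) x)) = inner ℝ _ _
  rw [real_inner_comm]
  rfl

/-! ### The nonlinear term against high modes -/

theorem exists_rpow_neg_le {p δ : ℝ} (hp : 0 < p) (hδ : 0 < δ) : ∃ L : ℝ, 0 < L ∧ L ^ (-p) ≤ δ := by
  have h := (tendsto_rpow_neg_atTop hp).eventually (ge_mem_nhds hδ)
  obtain ⟨L, h1, h2⟩ := (h.and (eventually_gt_atTop 0)).exists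
  exact ⟨L, h2, h1⟩

/-- Strict subquadratic growth: `y^q` is absorbed by a small multiple of `y²` and a constant. -/
theorem exists_rpow_le {q η : ℝ} (hq₀ : 0 ≤ q) (hq₂ : q < 2) (hη : 0 < η) :
    ∃ K : ℝ, 0 ≤ K ∧ ∀ y : ℝ, 0 ≤ y → y ^ q ≤ η * y ^ 2 + K := by
  obtain ⟨L, hL, hL'⟩ := exists_rpow_neg_le (sub_pos.2 hq₂) hη
  refine ⟨L ^ q, by positivity, fun y hy => ?_⟩
  rcases le_total y L with h | h
  · have := Real.rpow_le_rpow hy h hq₀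
    nlinarith [sq_nonneg y]
  · have hy0 : 0 < y := hL.trans_le h
    have h1 : y ^ (-(2 - q)) ≤ η :=
      (Real.rpow_le_rpow_of_nonpos hL h (by linarith)).trans hL'
    have h2 : y ^ q = y ^ (-(2 - q)) * y ^ 2 := by
      rw [← Real.rpow_two, ← Real.rpow_add hy0]; congr 1; ring
    have h3 : 0 ≤ L ^ q := by positivity
    rw [h2]
    have := mul_le_mul_of_nonneg_right h1 (sq_nonneg y)
    linarith

theorem integrable_norm_mul_norm (f g : H) : Integrable (fun x => ‖f x‖ * ‖g x‖) volume := by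
  have := MemLp.integrable_mul (p := 2) (q := 2) (Lp.memLp f).norm (Lp.memLp g).norm
  exact this

theorem integral_norm_mul_norm_le (f g : H) : ∫ x, ‖f x‖ * ‖g x‖ ≤ ‖f‖ * ‖g‖ := by
  have h := integral_mul_le_Lp_mul_Lq_of_nonneg (μ := volume)
    (f := fun x => ‖f x‖) (g := fun x => ‖g x‖) Real.HolderConjugate.two_two
    (Eventually.of_forall fun _ => norm_nonneg _) (Eventually.of_forall fun _ => norm_nonneg _)
    (by simpa using (Lp.memLp f).norm) (by simpa using (Lp.memLp g).norm)
  simp only [← Real.sqrt_eq_rpow, Real.rpow_ofNat, ← norm_sq_eq_integral,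
    Real.sqrt_sq (norm_nonneg _)] at h
  exact h

theorem integral_le_of_ae_le_add_indicator {F : ℝ → ℝ} (hF : AEStronglyMeasurable F volume)
    (hF0 : ∀ x, 0 ≤ F x) (w z : H) {A B R : ℝ} (hA : 0 ≤ A) (hB : 0 ≤ B)
    (h : ∀ᵐ x, F x ≤ A * (‖w x‖ * ‖z x‖) + (Icc (-R) R).indicator (fun x => B * ‖w x‖) x) :
    Integrable F volume ∧
      ∫ x, F x ≤ A * (‖w‖ * ‖z‖) + B * (√(volume.real (Icc (-R) R)) * ‖w‖) := by
  have hwI : IntegrableOn (fun x => B * ‖w x‖) (Icc (-R) R) :=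
    ((locallyIntegrable_coe w).integrableOn_isCompact isCompact_Icc).norm.const_mul _
  have i1 := (integrable_norm_mul_norm w z).const_mul A
  have i2 := hwI.integrable_indicator measurableSet_Icc
  refine ⟨(i1.add i2).mono' hF ?_, ?_⟩
  · filter_upwards [h] with x hx
    rw [Real.norm_of_nonneg (hF0 x)]
    exact hx
  · refine (integral_mono_of_nonneg (Eventually.of_forall hF0) (i1.add i2) h).trans ?_
    have e1 := integral_add i1 i2
    simp only [Pi.add_apply] at e1 ⊢
    rw [e1, integral_const_mul, integral_indicator measurableSet_Icc, integral_const_mul]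
    exact add_le_add (mul_le_mul_of_nonneg_left (integral_norm_mul_norm_le w z) hA)
      (mul_le_mul_of_nonneg_left (setIntegral_norm_le w (by simp)) hB)

/-- The trilinear estimate behind the squeezing property. Near the origin the high modes `z` are
small by `exists_local_bound`; far from the origin `f` is small because `ψ f` is bounded and the
weight `ψ` is large there at late times. -/
theorem exists_trilinear_bound {q : ℝ} (hq₀ : 0 < q) (hq₂ : q < 2) (e : HilbertBasis ℕ ℝ H)
    {δ : ℝ} (hδ : 0 < δ) :
    ∃ (T : ℝ≥0) (N : ℕ), 0 < T ∧ ∀ t : ℝ≥0, T ≤ t → ∀ f w z : H, MemH1 f → MemH1 z →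
      (∀ j < N, inner ℝ (e j) z = 0) → ‖z‖ ≤ ‖w‖ →
      Integrable (fun x => ‖f x‖ ^ q * (‖w x‖ * ‖z x‖)) volume ∧
      ∫ x, ‖f x‖ ^ q * (‖w x‖ * ‖z x‖) ≤
        δ * (1 + (‖f‖ ^ 2 + ‖dx f‖ ^ 2) + (‖psiMul t f‖ ^ 2 + ‖dx (psiMul t f)‖ ^ 2)) * ‖w‖ ^ 2
          + δ * ‖dx z‖ ^ 2 := by
  obtain ⟨K, hK0, hK⟩ := exists_rpow_le hq₀.le hq₂ (show 0 < δ / 6 by positivity)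
  obtain ⟨L, hL, hLδ⟩ := exists_rpow_neg_le hq₀ (show 0 < δ / 6 by positivity)
  obtain ⟨R, hR⟩ := exists_le_phi (2 * L)
  set c : ℝ := √(volume.real (Icc (-R) R)) with hc
  have hc0 : 0 ≤ c := Real.sqrt_nonneg _
  -- `κ` is chosen so that `K κ c ≤ δ / 2`; the summand `1` covers `K c = 0`.
  set κ : ℝ := δ / (2 * (K * c + 1)) with hκ
  have hκ0 : 0 < κ := by positivity
  have hKκ : K * κ * c ≤ δ / 2 := by
    rw [hκ, mul_div_assoc', div_mul_eq_mul_div, div_le_div_iff₀ (by positivity) (by positivity)]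
    nlinarith
  obtain ⟨N, hN⟩ := exists_local_bound e R hκ0
  refine ⟨(2 * L).toNNReal, N, by simpa using hL, fun t ht f w z hf hz horth hzw => ?_⟩
  have ht' : 2 * L ≤ t := by
    have := NNReal.coe_le_coe.2 ht
    rwa [Real.coe_toNNReal _ (by positivity)] at this
  set S := ‖f‖ ^ 2 + ‖dx f‖ ^ 2 with hS
  set S' := ‖psiMul t f‖ ^ 2 + ‖dx (psiMul t f)‖ ^ 2 with hS'
  have hS0 : 0 ≤ S := by positivity
  have hS0' : 0 ≤ S' := by positivity
  set Z := ‖z‖ + ‖dx z‖ with hZ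
  have hpt : ∀ᵐ x, ‖f x‖ ^ q * (‖w x‖ * ‖z x‖) ≤
      (δ * S + δ / 6 * (1 + 6 * S')) * (‖w x‖ * ‖z x‖)
        + (Icc (-R) R).indicator (fun x => K * κ * Z * ‖w x‖) x := by
    filter_upwards [hf.ae_norm_le, (hf.psiMul t).ae_norm_le, coeFn_psiMul t f,
      hN z hz horth] with x h1 h2 h3 h4
    have hwz : 0 ≤ ‖w x‖ * ‖z x‖ := by positivity
    have hB := supBound_sq_le f
    have hB' := supBound_sq_le (psiMul t f)
    by_cases hx : |x| ≤ R
    · have hx' : x ∈ Icc (-R) R := abs_le.1 hx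
      rw [indicator_of_mem hx']
      have h5 := hK ‖f x‖ (norm_nonneg _)
      have h6 : ‖f x‖ ^ 2 ≤ 6 * S := (pow_le_pow_left₀ (norm_nonneg _) h1 2).trans hB
      have h7 : ‖f x‖ ^ q ≤ δ * S + K := by
        have := mul_le_mul_of_nonneg_left h6 (show 0 ≤ δ / 6 by positivity)
        linarith
      have h8 : K * (‖w x‖ * ‖z x‖) ≤ K * κ * Z * ‖w x‖ := by
        calc K * (‖w x‖ * ‖z x‖) ≤ K * (‖w x‖ * (κ * Z)) := by gcongr; exact h4 hx
          _ = _ := by ring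
      have h9 := mul_le_mul_of_nonneg_right h7 hwz
      have h10 : 0 ≤ δ / 6 * (1 + 6 * S') * (‖w x‖ * ‖z x‖) := by positivity
      linarith
    · have hx' : x ∉ Icc (-R) R := fun h => hx (abs_le.2 h)
      rw [indicator_of_notMem hx', add_zero]
      have h5 := le_psi hL ht' (hR x (not_le.1 hx))
      have h6 : L * ‖f x‖ ≤ supBound (psiMul t f) := by
        refine le_trans ?_ h2
        rw [h3, norm_mul, Complex.norm_real, Real.norm_eq_abs]
        exact mul_le_mul_of_nonneg_right (h5.trans (le_abs_self _)) (norm_nonneg _)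
      have h7 : ‖f x‖ ^ q = L ^ (-q) * (L * ‖f x‖) ^ q := by
        rw [Real.mul_rpow hL.le (norm_nonneg _), ← mul_assoc, ← Real.rpow_add hL]
        simp
      have h8 : (L * ‖f x‖) ^ q ≤ 1 + 6 * S' := by
        have h9 := rpow_le_one_add_sq (supBound_nonneg (psiMul t f)) hq₀.le hq₂.le
        have h10 := Real.rpow_le_rpow (by positivity) h6 hq₀.le
        linarith
      have h9 : ‖f x‖ ^ q ≤ δ / 6 * (1 + 6 * S') := by
        rw [h7]
        exact mul_le_mul hLδ h8 (by positivity) (by positivity)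
      have h10 := mul_le_mul_of_nonneg_right h9 hwz
      have h11 : 0 ≤ δ * S * (‖w x‖ * ‖z x‖) := by positivity
      linarith
  obtain ⟨hI, hle⟩ := integral_le_of_ae_le_add_indicator
    ((((Lp.aestronglyMeasurable f).norm.aemeasurable.pow_const q).aestronglyMeasurable).mul
      (integrable_norm_mul_norm w z).aestronglyMeasurable)
    (fun x => mul_nonneg (by positivity) (by positivity)) w z
    (by positivity) (by positivity) hpt
  rw [← hc] at hle
  refine ⟨hI, hle.trans ?_⟩
  have h3 : K * κ * Z * (c * ‖w‖) ≤ δ / 2 * ((‖w‖ + ‖dx z‖) * ‖w‖) := by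
    calc K * κ * Z * (c * ‖w‖) = K * κ * c * (Z * ‖w‖) := by ring
      _ ≤ δ / 2 * ((‖w‖ + ‖dx z‖) * ‖w‖) := by
          gcongr
          exact add_le_add_left hzw _
  have h4 : (δ * S + δ / 6 * (1 + 6 * S')) * (‖w‖ * ‖z‖)
      ≤ (δ * S + δ / 6 * (1 + 6 * S')) * ‖w‖ ^ 2 := by rw [pow_two]; gcongr
  have h5 : δ * (2 * ‖w‖ * ‖dx z‖) ≤ δ * (‖w‖ ^ 2 + ‖dx z‖ ^ 2) :=
    mul_le_mul_of_nonneg_left (two_mul_le_add_sq _ _) hδ.le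
  have h6 : 0 ≤ δ * ‖w‖ ^ 2 := by positivity
  have h7 : 0 ≤ δ * ‖dx z‖ ^ 2 := by positivity
  clear_value S S' Z c κ
  clear hpt hle hI hN hR hK
  linarith

/-- The sum of the squared `H¹`-norms of `f` and of `ψ(t, ·) f`, as a real number. -/
noncomputable def energy (t : ℝ≥0) (f : H) : ℝ :=
  (‖f‖ ^ 2 + ‖dx f‖ ^ 2) + (‖psiMul t f‖ ^ 2 + ‖dx (psiMul t f)‖ ^ 2)

/-- For late times and sufficiently many modes, the nonlinear term tested with the high modes `z` of
`w = u - v` is absorbed by the dissipation, the damping, and a small multiple of the energy. -/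
theorem exists_nonlinear_bound {a q ν₁ : ℝ} (ha : 0 < a) (hq₀ : 0 < q) (hq₂ : q < 2) (hν : 0 < ν₁)
    (α : ℂ) (e : HilbertBasis ℕ ℝ H) {ε : ℝ} (hε : 0 < ε) :
    ∃ (T : ℝ≥0) (N : ℕ), 0 < T ∧ 1 ≤ N ∧ ∀ t : ℝ≥0, T ≤ t → ∀ u v z : H,
      MemH1 u → MemH1 v → MemH1 z → (∀ j < N, inner ℝ (e j) z = 0) → ‖z‖ ≤ ‖u - v‖ →
      2 * |inner ℝ (α • powMul q u - α • powMul q v) z| ≤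
        ν₁ * ‖dx z‖ ^ 2
          + (a + (6 * ‖α‖ + 1) * ε * (energy t u + energy t v)) * ‖u - v‖ ^ 2 := by
  -- `12 |α| δ` is at most `a` and `ν₁`: the factor is `2` from the left-hand side, `3` from the
  -- Lipschitz bound and `2` from the sum over `u` and `v`.
  set δ : ℝ := min ε (min a ν₁ / (12 * ‖α‖ + 1)) with hδ
  have hα := norm_nonneg α
  have hδ0 : 0 < δ := lt_min hε (div_pos (lt_min ha hν) (by positivity))
  have hδε : δ ≤ ε := min_le_left _ _
  have hδ1 : 12 * ‖α‖ * δ ≤ min a ν₁ := by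
    have : δ ≤ min a ν₁ / (12 * ‖α‖ + 1) := min_le_right _ _
    rw [le_div_iff₀ (by positivity)] at this
    nlinarith
  have hδa : 12 * ‖α‖ * δ ≤ a := hδ1.trans (min_le_left _ _)
  have hδν : 12 * ‖α‖ * δ ≤ ν₁ := hδ1.trans (min_le_right _ _)
  obtain ⟨T, N, hT, h⟩ := exists_trilinear_bound hq₀ hq₂ e hδ0
  refine ⟨T, max N 1, hT, le_max_right _ _, fun t ht u v z hu hv hz horth hzw => ?_⟩
  have horth' : ∀ j < N, inner ℝ (e j) z = 0 := fun j hj => horth j (hj.trans_le (le_max_left _ _))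
  obtain ⟨iu, bu⟩ := h t ht u (u - v) z hu hz horth' hzw
  obtain ⟨iv, bv⟩ := h t ht v (u - v) z hv hz horth' hzw
  set w := u - v with hw
  have key : |inner ℝ (α • powMul q u - α • powMul q v) z| ≤ 3 * ‖α‖ *
      ((∫ x, ‖u x‖ ^ q * (‖w x‖ * ‖z x‖)) + ∫ x, ‖v x‖ ^ q * (‖w x‖ * ‖z x‖)) := by
    rw [L2.inner_def, ← integral_add iu iv, ← integral_const_mul, ← Real.norm_eq_abs]
    refine norm_integral_le_of_norm_le ((iu.add iv).const_mul _) ?_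
    filter_upwards [hu.coeFn_powMul hq₀.le, hv.coeFn_powMul hq₀.le, Lp.coeFn_smul α (powMul q u),
      Lp.coeFn_smul α (powMul q v), Lp.coeFn_sub (α • powMul q u) (α • powMul q v),
      Lp.coeFn_sub u v] with x h1 h2 h3 h4 h5 h6
    refine (norm_inner_le_norm _ _).trans ?_
    rw [h5, Pi.sub_apply, h3, h4, Pi.smul_apply, Pi.smul_apply, h1, h2, ← smul_sub, norm_smul, hw,
      h6, Pi.sub_apply]
    have h7 := norm_pow_smul_sub_le hq₀.le hq₂.le (u x) (v x)
    calc ‖α‖ * ‖(‖u x‖ ^ q : ℝ) • u x - (‖v x‖ ^ q : ℝ) • v x‖ * ‖z x‖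
        ≤ ‖α‖ * (3 * (‖u x‖ ^ q + ‖v x‖ ^ q) * ‖u x - v x‖) * ‖z x‖ := by gcongr
      _ = _ := by ring
  have hE : 0 ≤ energy t u + energy t v := by unfold energy; positivity
  have h1 : 2 * |inner ℝ (α • powMul q u - α • powMul q v) z| ≤
      6 * ‖α‖ * (δ * (2 + (energy t u + energy t v)) * ‖w‖ ^ 2 + 2 * (δ * ‖dx z‖ ^ 2)) := by
    unfold energy
    have := mul_le_mul_of_nonneg_left (add_le_add bu bv) (show 0 ≤ 6 * ‖α‖ by positivity)
    linarith
  refine h1.trans ?_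
  have h2 : 12 * ‖α‖ * δ * ‖dx z‖ ^ 2 ≤ ν₁ * ‖dx z‖ ^ 2 := by gcongr
  have h3 : 12 * ‖α‖ * δ * ‖w‖ ^ 2 ≤ a * ‖w‖ ^ 2 := by gcongr
  have h4 : 6 * ‖α‖ * δ * (energy t u + energy t v) * ‖w‖ ^ 2
      ≤ (6 * ‖α‖ + 1) * ε * (energy t u + energy t v) * ‖w‖ ^ 2 := by
    gcongr; linarith
  linarith

/-! ### The energy identity -/

section Energy

variable {E : Type*} [NormedAddCommGroup E]

/-- The translate `r ↦ f (σ + r)` of `f ∈ L²(ℝ; E)`. -/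
noncomputable def translate (σ : ℝ) (f : Lp E 2 (volume : Measure ℝ)) :
    Lp E 2 (volume : Measure ℝ) :=
  DomAddAct.mk σ +ᵥ f

theorem coeFn_translate (σ : ℝ) (f : Lp E 2 (volume : Measure ℝ)) :
    translate σ f =ᵐ[volume] fun r => f (σ + r) :=
  DomAddAct.vadd_Lp_ae_eq (DomAddAct.mk σ) f

theorem continuous_translate (f : Lp E 2 (volume : Measure ℝ)) :
    Continuous fun σ => translate σ f := by
  have : Fact ((2 : ℝ≥0∞) ≠ ∞) := ⟨by norm_num⟩
  have h : Continuous (DomAddAct.mk : ℝ → ℝᵈᵃᵃ) := DomAddAct.continuous_mk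
  exact h.vadd continuous_const

theorem integrable_norm_sq_Lp (f : Lp E 2 (volume : Measure ℝ)) :
    Integrable (fun x => ‖f x‖ ^ 2) volume :=
  (memLp_two_iff_integrable_sq_norm (Lp.aestronglyMeasurable f)).1 (Lp.memLp f)

variable [InnerProductSpace ℝ E]

/-- The pairing of a translate of `G` with `Y` over `(s, t]`, integrated over the translation
parameter in `(0, h]`, may be computed in either order. -/
theorem integral_integral_translate (G Y : Lp E 2 (volume : Measure ℝ)) (s t : ℝ) {h : ℝ}
    (hh : 0 ≤ h) :
    ∫ r in Ioc s t, ∫ σ in (0 : ℝ)..h, inner ℝ (G (σ + r)) (Y r)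
      = ∫ σ in (0 : ℝ)..h, ∫ r in Ioc s t, inner ℝ (translate σ G r) (Y r) := by
  simp_rw [intervalIntegral.integral_of_le hh]
  rw [integral_integral_swap]
  · refine integral_congr_ae (Eventually.of_forall fun σ => ?_)
    refine integral_congr_ae (ae_restrict_of_ae ?_)
    filter_upwards [coeFn_translate σ G] with r hr
    rw [hr]
  · have hmeas : StronglyMeasurable (fun p : ℝ × ℝ => inner ℝ (G (p.2 + p.1)) (Y p.1)) :=
      ((Lp.stronglyMeasurable G).comp_measurable (measurable_snd.add measurable_fst)).inner
        ((Lp.stronglyMeasurable Y).comp_measurable measurable_fst)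
    have hb : ∀ σ r, ‖inner ℝ (G (σ + r)) (Y r)‖ ≤ ‖G (σ + r)‖ ^ 2 + ‖Y r‖ ^ 2 := by
      intro σ r
      refine (norm_inner_le_norm _ _).trans ?_
      nlinarith [sq_nonneg (‖G (σ + r)‖ - ‖Y r‖), sq_nonneg ‖G (σ + r)‖, sq_nonneg ‖Y r‖]
    have hi : ∀ σ : ℝ, Integrable (fun r => ‖G (σ + r)‖ ^ 2 + ‖Y r‖ ^ 2) volume := fun σ =>
      ((integrable_norm_sq_Lp G).comp_add_left σ).add (integrable_norm_sq_Lp Y)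
    have hmσ : ∀ σ : ℝ, StronglyMeasurable (fun r : ℝ => inner ℝ (G (σ + r)) (Y r)) := fun σ =>
      hmeas.comp_measurable (measurable_id.prodMk measurable_const)
    refine (integrable_prod_iff' hmeas.aestronglyMeasurable).2 ⟨?_, ?_⟩
    · exact Eventually.of_forall fun σ => ((hi σ).mono' (hmσ σ).aestronglyMeasurable
        (Eventually.of_forall (hb σ))).restrict
    · refine Integrable.mono' (g := fun _ => (∫ r, ‖G r‖ ^ 2) + ∫ r, ‖Y r‖ ^ 2) (by simp) ?_ ?_
      · exact (hmeas.norm.integral_prod_left').aestronglyMeasurable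
      · refine Eventually.of_forall fun σ => ?_
        rw [Real.norm_of_nonneg (integral_nonneg fun _ => norm_nonneg _)]
        calc ∫ r in Ioc s t, ‖inner ℝ (G (σ + r)) (Y r)‖
            ≤ ∫ r in Ioc s t, (‖G (σ + r)‖ ^ 2 + ‖Y r‖ ^ 2) :=
              integral_mono_of_nonneg (Eventually.of_forall fun _ => norm_nonneg _)
                (hi σ).restrict (Eventually.of_forall (hb σ))
          _ ≤ ∫ r, (‖G (σ + r)‖ ^ 2 + ‖Y r‖ ^ 2) :=
              setIntegral_le_integral (hi σ) (Eventually.of_forall fun _ => by positivity)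
          _ = _ := by
              rw [integral_add ((integrable_norm_sq_Lp G).comp_add_left σ)
                (integrable_norm_sq_Lp Y), integral_add_left_eq_self (fun r => ‖G r‖ ^ 2)]

/-- Continuity of translations in `L²(ℝ; E)` gives the limit of the averaged pairings. -/
theorem tendsto_average_translate (G X : Lp E 2 (volume : Measure ℝ)) (s t : ℝ) :
    Tendsto (fun h : ℝ => h⁻¹ * ∫ r in Ioc s t, ∫ σ in (0 : ℝ)..h,
        inner ℝ (G (σ + r)) (X (h + r) + X r)) (𝓝[>] 0)
      (𝓝 (2 * ∫ r in Ioc s t, inner ℝ (G r) (X r))) := by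
  set Res := LpToLpRestrictCLM ℝ E ℝ (volume : Measure ℝ) 2 (Ioc s t) with hRes
  set J : ℝ × ℝ → ℝ := fun p => inner ℝ (Res (translate p.1 G)) (Res (translate p.2 X + X)) with hJ
  have hJc : Continuous J :=
    (Res.continuous.comp ((continuous_translate G).comp continuous_fst)).inner
      (Res.continuous.comp (((continuous_translate X).comp continuous_snd).add continuous_const))
  have hJi : ∀ (A B : Lp E 2 (volume : Measure ℝ)),
      inner ℝ (Res A) (Res B) = ∫ r in Ioc s t, inner ℝ (A r) (B r) := by
    intro A B
    rw [L2.inner_def]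
    refine integral_congr_ae ?_
    filter_upwards [LpToLpRestrictCLM_coeFn ℝ (Ioc s t) A,
      LpToLpRestrictCLM_coeFn ℝ (Ioc s t) B] with r h1 h2
    rw [h1, h2]
  have hJ0 : J (0, 0) = 2 * ∫ r in Ioc s t, inner ℝ (G r) (X r) := by
    have h0 : ∀ f : Lp E 2 (volume : Measure ℝ), translate 0 f = f := fun f => by
      refine Lp.ext ?_
      filter_upwards [coeFn_translate 0 f] with r hr
      rw [hr, zero_add]
    simp only [hJ, h0]
    rw [← two_smul ℝ X, map_smul, real_inner_smul_right, hJi]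
  have hav : ∀ h : ℝ, 0 < h → ∫ r in Ioc s t, ∫ σ in (0 : ℝ)..h,
      inner ℝ (G (σ + r)) (X (h + r) + X r) = ∫ σ in (0 : ℝ)..h, J (σ, h) := by
    intro h hh
    have e1 : ∫ r in Ioc s t, ∫ σ in (0 : ℝ)..h, inner ℝ (G (σ + r)) (X (h + r) + X r)
        = ∫ r in Ioc s t, ∫ σ in (0 : ℝ)..h,
          inner ℝ (G (σ + r)) ((translate h X + X : Lp E 2 (volume : Measure ℝ)) r) := by
      refine integral_congr_ae (ae_restrict_of_ae ?_)
      filter_upwards [coeFn_translate h X, Lp.coeFn_add (translate h X) X] with r h1 h2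
      rw [h2, Pi.add_apply, h1]
    rw [e1, integral_integral_translate G _ s t hh.le]
    refine intervalIntegral.integral_congr fun σ _ => ?_
    simp only [hJ, hJi]
  rw [← hJ0, Metric.tendsto_nhdsWithin_nhds]
  intro ε hε
  obtain ⟨δ, hδ, hδ'⟩ := Metric.continuous_iff.1 hJc (0, 0) (ε / 2) (half_pos hε)
  refine ⟨δ, hδ, fun {h} hh hd => ?_⟩
  have hh0 : 0 < h := hh
  rw [Real.dist_eq, sub_zero, abs_of_pos hh0] at hd
  rw [hav h hh0, Real.dist_eq]
  have hJint : IntervalIntegrable (fun σ => J (σ, h)) volume 0 h :=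
    (hJc.comp (continuous_id.prodMk continuous_const)).intervalIntegrable _ _
  have e2 : h⁻¹ * (∫ σ in (0 : ℝ)..h, J (σ, h)) - J (0, 0)
      = h⁻¹ * ∫ σ in (0 : ℝ)..h, (J (σ, h) - J (0, 0)) := by
    rw [intervalIntegral.integral_sub hJint (by simp), intervalIntegral.integral_const, mul_sub,
      smul_eq_mul, sub_zero, ← mul_assoc, inv_mul_cancel₀ hh0.ne', one_mul]
  have hb : ‖∫ σ in (0 : ℝ)..h, (J (σ, h) - J (0, 0))‖ ≤ ε / 2 * |h - 0| := by
    refine intervalIntegral.norm_integral_le_of_norm_le_const fun σ hσ => ?_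
    rw [uIoc_of_le hh0.le] at hσ
    rw [← dist_eq_norm]
    refine (hδ' (σ, h) ?_).le
    rw [Prod.dist_eq, Real.dist_eq, Real.dist_eq, sub_zero, sub_zero, abs_of_pos hσ.1,
      abs_of_pos hh0]
    exact max_lt (hσ.2.trans_lt hd) hd
  rw [sub_zero, abs_of_pos hh0, Real.norm_eq_abs] at hb
  rw [e2, abs_mul, abs_of_pos (inv_pos.2 hh0)]
  calc h⁻¹ * |∫ σ in (0 : ℝ)..h, (J (σ, h) - J (0, 0))| ≤ h⁻¹ * (ε / 2 * h) := by gcongr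
    _ = ε / 2 := by field_simp
    _ < ε := half_lt_self hε

variable {F : Type*} [NormedAddCommGroup F] [InnerProductSpace ℝ F]

/-- The energy identity for a weak evolution equation `w' = G`, where `G` is paired with `X`, the
representation of `w` in the energy space. The identity is only assumed when tested with the
values `w r` at almost every time. The increment `‖w(r+h)‖² - ‖w(r)‖²` is
`⟨w(r+h) - w(r), w(r+h) + w(r)⟩`, to which the hypothesis applies; averaging in `r` and letting
`h → 0` gives the claim without differentiating in time. -/
theorem norm_sq_sub_norm_sq_eq {w : ℝ → F} (hw : Continuous w) {G X : ℝ → E}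
    (hG : ∀ τ : ℝ, MemLp G 2 (volume.restrict (Ioc 0 τ)))
    (hX : ∀ τ : ℝ, MemLp X 2 (volume.restrict (Ioc 0 τ)))
    (hweak : ∀ᵐ r ∂(volume.restrict (Ioi (0 : ℝ))), ∀ s t : ℝ, 0 ≤ s → s ≤ t →
      inner ℝ (w t - w s) (w r) = ∫ ρ in s..t, inner ℝ (G ρ) (X r))
    {s t : ℝ} (hs : 0 ≤ s) (hst : s ≤ t) :
    ‖w t‖ ^ 2 - ‖w s‖ ^ 2 = 2 * ∫ r in s..t, inner ℝ (G r) (X r) := by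
  -- Cutting off at `t + 1` leaves room for shifts by `h ≤ 1` of times in `(s, t]`.
  set τ := t + 1 with hτ
  have hG' := (memLp_indicator_iff_restrict measurableSet_Ioc).2 (hG τ)
  have hX' := (memLp_indicator_iff_restrict measurableSet_Ioc).2 (hX τ)
  set 𝔾 : Lp E 2 (volume : Measure ℝ) := hG'.toLp _ with h𝔾
  set 𝕏 : Lp E 2 (volume : Measure ℝ) := hX'.toLp _ with h𝕏
  have a𝔾 : ∀ᵐ r, r ∈ Ioc 0 τ → 𝔾 r = G r := by
    filter_upwards [hG'.coeFn_toLp] with r hr hrτ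
    rw [h𝔾, hr, indicator_of_mem hrτ]
  have a𝕏 : ∀ᵐ r, r ∈ Ioc 0 τ → 𝕏 r = X r := by
    filter_upwards [hX'.coeFn_toLp] with r hr hrτ
    rw [h𝕏, hr, indicator_of_mem hrτ]
  have hweak' := (ae_restrict_iff' measurableSet_Ioi).1 hweak
  set n : ℝ → ℝ := fun r => ‖w r‖ ^ 2 with hn
  have hnc : Continuous n := by fun_prop
  have hlim := tendsto_average_translate 𝔾 𝕏 s t
  have h𝔾i : ∀ (x : E) (a b : ℝ), IntervalIntegrable (fun ρ => inner ℝ (𝔾 ρ) x) volume a b := by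
    intro x a b
    have : LocallyIntegrable (fun ρ => inner ℝ (𝔾 ρ) x) volume :=
      ((Lp.memLp 𝔾).inner_const x).locallyIntegrable (by norm_num)
    exact intervalIntegrable_iff.2
      ((this.integrableOn_isCompact isCompact_uIcc).mono_set uIoc_subset_uIcc)
  -- For small `h`, the averaged pairing is the difference quotient of a primitive of `‖w‖²`.
  have hev : ∀ᶠ h : ℝ in 𝓝[>] 0, h⁻¹ * ∫ r in Ioc s t, ∫ σ in (0 : ℝ)..h,
      inner ℝ (𝔾 (σ + r)) (𝕏 (h + r) + 𝕏 r)
      = h⁻¹ • ((∫ r in (0 : ℝ)..(t + h), n r) - ∫ r in (0 : ℝ)..t, n r)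
        - h⁻¹ • ((∫ r in (0 : ℝ)..(s + h), n r) - ∫ r in (0 : ℝ)..s, n r) := by
    filter_upwards [Ioc_mem_nhdsGT (zero_lt_one (α := ℝ))] with h hh
    have hh0 : 0 < h := hh.1
    have e1 : ∫ r in Ioc s t, ∫ σ in (0 : ℝ)..h, inner ℝ (𝔾 (σ + r)) (𝕏 (h + r) + 𝕏 r)
        = ∫ r in Ioc s t, (n (r + h) - n r) := by
      refine setIntegral_congr_ae measurableSet_Ioc ?_
      have hshift : ∀ {p : ℝ → Prop}, (∀ᵐ r, p r) → ∀ᵐ r, p (h + r) := fun hp =>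
        (measurePreserving_add_left volume h).quasiMeasurePreserving.ae hp
      filter_upwards [hweak', hshift hweak', a𝕏, hshift a𝕏] with r h1 h2 h3 h4 hr
      have hr0 : 0 < r := hs.trans_lt hr.1
      rw [h3 ⟨hr0, by linarith [hr.2]⟩, h4 ⟨by linarith, by linarith [hr.2, hh.2]⟩]
      rw [intervalIntegral.integral_comp_add_right (fun ρ => inner ℝ (𝔾 ρ) (X (h + r) + X r)) r,
        zero_add]
      simp_rw [inner_add_right]
      rw [intervalIntegral.integral_add (h𝔾i _ _ _) (h𝔾i _ _ _)]
      have hc : ∀ x : E, ∫ ρ in r..(h + r), inner ℝ (𝔾 ρ) x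
          = ∫ ρ in r..(h + r), inner ℝ (G ρ) x := by
        intro x
        refine intervalIntegral.integral_congr_ae ?_
        filter_upwards [a𝔾] with ρ hρ hρr
        rw [uIoc_of_le (by linarith)] at hρr
        rw [hρ ⟨by linarith [hρr.1], by linarith [hρr.2, hr.2, hh.2]⟩]
      rw [hc, hc, ← h1 hr0 r (h + r) hr0.le (by linarith),
        ← h2 (show (0 : ℝ) < h + r by linarith) r (h + r) hr0.le (by linarith), add_comm r h]
      simp only [hn]
      rw [← real_inner_self_eq_norm_sq, ← real_inner_self_eq_norm_sq, inner_sub_left,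
        inner_sub_left, real_inner_comm (w r) (w (h + r))]
      ring
    have e2 : ∫ r in Ioc s t, (n (r + h) - n r)
        = (∫ r in (s + h)..(t + h), n r) - ∫ r in s..t, n r := by
      rw [← intervalIntegral.integral_of_le hst, intervalIntegral.integral_sub
        (f := fun r => n (r + h))
        ((hnc.comp (continuous_add_const h)).intervalIntegrable _ _) (hnc.intervalIntegrable _ _),
        intervalIntegral.integral_comp_add_right]
    have hi : ∀ a b, IntervalIntegrable n volume a b := fun a b => hnc.intervalIntegrable _ _
    rw [e1, e2, ← intervalIntegral.integral_interval_sub_left (hi 0 (t + h)) (hi 0 (s + h)),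
      ← intervalIntegral.integral_interval_sub_left (hi 0 t) (hi 0 s), smul_eq_mul, smul_eq_mul]
    ring
  have hder : ∀ x : ℝ, Tendsto (fun h : ℝ => h⁻¹ • ((∫ r in (0 : ℝ)..(x + h), n r)
      - ∫ r in (0 : ℝ)..x, n r)) (𝓝[>] 0) (𝓝 (n x)) := fun x =>
    ((hasDerivAt_iff_tendsto_slope_zero.1 (hnc.integral_hasStrictDerivAt 0 x).hasDerivAt)).mono_left
      (nhdsGT_le_nhdsNE 0)
  have hlim' := ((hder t).sub (hder s)).congr' (hev.mono fun _ h => h.symm)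
  have := tendsto_nhds_unique hlim' hlim
  rw [show ‖w t‖ ^ 2 - ‖w s‖ ^ 2 = n t - n s from rfl, this, intervalIntegral.integral_of_le hst]
  congr 1
  refine setIntegral_congr_ae measurableSet_Ioc ?_
  filter_upwards [a𝔾, a𝕏] with r h1 h2 hr
  have hr' : r ∈ Ioc 0 τ := ⟨hs.trans_lt hr.1, by linarith [hr.2]⟩
  rw [h1 hr', h2 hr']

end Energy

/-! ### A Grönwall inequality with an integrable coefficient -/

theorem abs_exp_sub_exp_le {M x y : ℝ} (hx : x ≤ M) (hy : y ≤ M) :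
    |Real.exp x - Real.exp y| ≤ Real.exp M * |x - y| := by
  have key : ∀ x y : ℝ, x ≤ M → y ≤ x → Real.exp x - Real.exp y ≤ Real.exp M * (x - y) := by
    intro x y hx hyx
    have h1 : Real.exp x - Real.exp y = Real.exp x * (1 - Real.exp (y - x)) := by
      rw [mul_sub, ← Real.exp_add]; ring_nf
    have h2 := Real.add_one_le_exp (y - x)
    rw [h1]
    exact mul_le_mul (Real.exp_le_exp.2 hx) (by linarith)
      (sub_nonneg.2 (Real.exp_le_one_iff.2 (by linarith))) (Real.exp_pos _).le
  rcases le_total y x with h | h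
  · rw [abs_of_nonneg (sub_nonneg.2 (Real.exp_le_exp.2 h)), abs_of_nonneg (sub_nonneg.2 h)]
    exact key x y hx h
  · rw [abs_sub_comm, abs_sub_comm x y, abs_of_nonneg (sub_nonneg.2 (Real.exp_le_exp.2 h)),
      abs_of_nonneg (sub_nonneg.2 h)]
    exact key y x hy h

theorem absolutelyContinuousOnInterval_exp {f : ℝ → ℝ} {a b : ℝ}
    (hf : AbsolutelyContinuousOnInterval f a b) :
    AbsolutelyContinuousOnInterval (fun x => Real.exp (f x)) a b := by
  obtain ⟨M, hM⟩ := hf.exists_bound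
  unfold AbsolutelyContinuousOnInterval at hf ⊢
  have hf' := hf.const_mul (Real.exp M)
  rw [mul_zero] at hf'
  refine squeeze_zero' (Eventually.of_forall fun E => Finset.sum_nonneg fun _ _ => dist_nonneg) ?_
    hf'
  have hE : ∀ᶠ E in (AbsolutelyContinuousOnInterval.totalLengthFilter ⊓
      𝓟 (AbsolutelyContinuousOnInterval.disjWithin a b)),
      E ∈ AbsolutelyContinuousOnInterval.disjWithin a b := eventually_inf_principal.mpr (by simp)
  filter_upwards [hE] with E hE
  rw [Finset.mul_sum]
  refine Finset.sum_le_sum fun i hi => ?_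
  have h := hE.1 i hi
  have hb : ∀ x ∈ uIcc a b, f x ≤ M := fun x hx =>
    (le_abs_self _).trans (by simpa [Real.norm_eq_abs] using hM x hx)
  rw [Real.dist_eq, Real.dist_eq]
  exact abs_exp_sub_exp_le (hb _ h.1) (hb _ h.2)

/-- If `m' ≤ -a m + k m + P e^{-2a(x-s)}` almost everywhere, with `k` integrable and nonnegative,
then `m(t) ≤ (m(s) + P/a) e^{-a(t-s) + ∫ k}`. The function
`e^{a(x-s) - ∫ₛˣ k} m(x) + (P/a) e^{-a(x-s)}` is absolutely continuous with nonpositive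
derivative. -/
theorem gronwall_of_intervalIntegrable {m d k : ℝ → ℝ} {a P s t : ℝ} (ha : 0 < a) (hP : 0 ≤ P)
    (hst : s ≤ t) (hd : IntervalIntegrable d volume s t) (hk : IntervalIntegrable k volume s t)
    (hk0 : ∀ x, 0 ≤ k x) (hm : ∀ x ∈ Icc s t, m x = m s + ∫ r in s..x, d r)
    (hle : ∀ᵐ x, x ∈ Ioc s t →
      d x ≤ -a * m x + k x * m x + P * Real.exp (-2 * a * (x - s))) :
    m t ≤ (m s + P / a) * Real.exp (-a * (t - s) + ∫ r in s..t, k r) := by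
  set K : ℝ → ℝ := fun x => ∫ r in s..x, k r with hK
  set M : ℝ → ℝ := fun x => m s + ∫ r in s..x, d r with hM
  set g : ℝ → ℝ := fun x => a * (x - s) - K x with hg
  have hsm : s ∈ uIcc s t := left_mem_uIcc
  have acK : AbsolutelyContinuousOnInterval K s t :=
    hk.absolutelyContinuousOnInterval_intervalIntegral hsm
  have acC : ∀ c : ℝ, AbsolutelyContinuousOnInterval (fun _ => c) s t := fun c =>
    (contDiffOn_const (n := 1)).absolutelyContinuousOnInterval
  have acM : AbsolutelyContinuousOnInterval M s t :=
    (acC (m s)).add (hd.absolutelyContinuousOnInterval_intervalIntegral hsm)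
  have aclin : AbsolutelyContinuousOnInterval (fun x => a * (x - s)) s t :=
    ContDiffOn.absolutelyContinuousOnInterval (by fun_prop)
  have acg : AbsolutelyContinuousOnInterval g s t := aclin.sub acK
  have acR : AbsolutelyContinuousOnInterval (fun x => P / a * Real.exp (-a * (x - s))) s t :=
    ContDiffOn.absolutelyContinuousOnInterval (by fun_prop)
  set z : ℝ → ℝ := fun x => Real.exp (g x) * M x + P / a * Real.exp (-a * (x - s)) with hz
  have acz : AbsolutelyContinuousOnInterval z s t :=
    ((absolutelyContinuousOnInterval_exp acg).mul acM).add acR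
  have hKnn : ∀ x ∈ Icc s t, 0 ≤ K x := fun x hx =>
    intervalIntegral.integral_nonneg hx.1 fun r _ => hk0 r
  have hdz : ∀ᵐ x, x ∈ Ioc s t → deriv z x ≤ 0 := by
    filter_upwards [hk.ae_hasDerivAt_integral, hd.ae_hasDerivAt_integral, hle] with x h1 h2 h3 hx
    have hxI : x ∈ Icc s t := Ioc_subset_Icc_self hx
    have hxu : x ∈ uIcc s t := by rwa [uIcc_of_le hst]
    have dK : HasDerivAt K (k x) x := h1 hxu s hsm
    have dM : HasDerivAt M (d x) x := (h2 hxu s hsm).const_add (m s)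
    have dlin : HasDerivAt (fun x => a * (x - s)) a x := by
      simpa using ((hasDerivAt_id x).sub_const s).const_mul a
    have dg : HasDerivAt g (a - k x) x := dlin.sub dK
    have dlin' : HasDerivAt (fun x => -a * (x - s)) (-a) x := by
      simpa using ((hasDerivAt_id x).sub_const s).const_mul (-a)
    have dR := dlin'.exp.const_mul (P / a)
    have dz : HasDerivAt z (Real.exp (g x) * (a - k x) * M x + Real.exp (g x) * d x
        + P / a * (Real.exp (-a * (x - s)) * -a)) x := (dg.exp.mul dM).add dR
    rw [dz.deriv]
    have hMm : M x = m x := (hm x hxI).symm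
    have h4 : Real.exp (g x) * d x ≤ Real.exp (g x) *
        (-a * m x + k x * m x + P * Real.exp (-2 * a * (x - s))) :=
      mul_le_mul_of_nonneg_left (h3 hx) (Real.exp_pos _).le
    have h5 : Real.exp (g x) * (P * Real.exp (-2 * a * (x - s))) ≤ P * Real.exp (-a * (x - s)) := by
      rw [mul_left_comm, ← Real.exp_add]
      refine mul_le_mul_of_nonneg_left (Real.exp_le_exp.2 ?_) hP
      have := hKnn x hxI
      simp only [hg]
      linarith
    have h6 : P / a * (Real.exp (-a * (x - s)) * -a) = -(P * Real.exp (-a * (x - s))) := by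
      field_simp
    rw [h6, hMm]
    linarith
  have hzle : z t ≤ z s := by
    rw [← sub_nonpos, ← acz.integral_deriv_eq_sub, intervalIntegral.integral_of_le hst]
    exact integral_nonpos_of_ae ((ae_restrict_iff' measurableSet_Ioc).2 hdz)
  have hzs : z s = m s + P / a := by simp [hz, hg, hK, hM]
  have hMt : M t = m t := (hm t ⟨hst, le_rfl⟩).symm
  have hRt : 0 ≤ P / a * Real.exp (-a * (t - s)) := by positivity
  have h7 : Real.exp (g t) * m t ≤ m s + P / a := by
    rw [hzs] at hzle
    simp only [hz, hMt] at hzle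
    linarith
  calc m t = Real.exp (g t) * m t * Real.exp (-g t) := by
        rw [mul_right_comm, ← Real.exp_add, add_neg_cancel, Real.exp_zero, one_mul]
    _ ≤ (m s + P / a) * Real.exp (-g t) := by gcongr
    _ = _ := by
        congr 2
        simp only [hg, hK]
        ring

/-- The same inequality when the coefficient is dominated by a function `κ` that is not assumed
measurable. It is applied with the smallest admissible coefficient, which is measurable. -/
theorem gronwall_of_lintegral {m d : ℝ → ℝ} {κ : ℝ → ℝ≥0∞} {a P s t : ℝ} (ha : 0 < a) (hP : 0 ≤ P)
    (hst : s ≤ t) (hmc : Continuous m) (hm0 : ∀ x, 0 ≤ m x)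
    (hd : IntervalIntegrable d volume s t) (hκ : ∫⁻ r in Ioc s t, κ r ≠ ⊤)
    (hm : ∀ x ∈ Icc s t, m x = m s + ∫ r in s..x, d r)
    (hle : ∀ᵐ x, x ∈ Ioc s t →
      d x ≤ -a * m x + (κ x).toReal * m x + P * Real.exp (-2 * a * (x - s))) :
    m t ≤ (m s + P / a) * Real.exp (-a * (t - s) + (∫⁻ r in Ioc s t, κ r).toReal) := by
  -- Where `m x = 0` the quotient is `0` by convention, and the term `k m` vanishes anyway.
  set k : ℝ → ℝ := fun x => max 0 ((d x + a * m x - P * Real.exp (-2 * a * (x - s))) / m x) with hk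
  have hk0 : ∀ x, 0 ≤ k x := fun x => le_max_left _ _
  have hkκ : ∀ᵐ x ∂(volume.restrict (Ioc s t)), ENNReal.ofReal (k x) ≤ κ x := by
    rw [ae_restrict_iff' measurableSet_Ioc]
    filter_upwards [hle] with x hx hxI
    refine le_trans (ENNReal.ofReal_le_ofReal ?_) ENNReal.ofReal_toReal_le
    refine max_le ENNReal.toReal_nonneg ?_
    rcases (hm0 x).eq_or_lt with h | h
    · rw [← h, div_zero]; exact ENNReal.toReal_nonneg
    · rw [div_le_iff₀ h]
      linarith [hx hxI]
  have hkm : AEStronglyMeasurable k (volume.restrict (Ioc s t)) := by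
    have h1 : AEMeasurable d (volume.restrict (Ioc s t)) := hd.1.aestronglyMeasurable.aemeasurable
    have h2 : Measurable m := hmc.measurable
    have h3 : Measurable (fun x => P * Real.exp (-2 * a * (x - s))) := by fun_prop
    exact (aemeasurable_const.max
      (((h1.add (h2.const_mul a).aemeasurable).sub h3.aemeasurable).div
        h2.aemeasurable)).aestronglyMeasurable
  have hki : IntegrableOn k (Ioc s t) := by
    refine ⟨hkm, ?_⟩
    rw [hasFiniteIntegral_iff_ofReal (Eventually.of_forall hk0)]
    exact (lintegral_mono_ae hkκ).trans_lt (lt_top_iff_ne_top.2 hκ)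
  have hkI : IntervalIntegrable k volume s t :=
    (intervalIntegrable_iff_integrableOn_Ioc_of_le hst).2 hki
  have hint : ∫ r in s..t, k r ≤ (∫⁻ r in Ioc s t, κ r).toReal := by
    rw [intervalIntegral.integral_of_le hst,
      integral_eq_lintegral_of_nonneg_ae (Eventually.of_forall hk0) hkm]
    exact ENNReal.toReal_mono hκ (lintegral_mono_ae hkκ)
  refine (gronwall_of_intervalIntegrable ha hP hst hd hkI hk0 hm ?_).trans ?_
  · filter_upwards [hle] with x hx hxI
    rcases (hm0 x).eq_or_lt with h | h
    · have := hx hxI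
      rw [← h] at this ⊢
      linarith
    · have h1 : (d x + a * m x - P * Real.exp (-2 * a * (x - s))) / m x ≤ k x := le_max_right _ _
      rw [div_le_iff₀ h] at h1
      linarith
  · have h1 : 0 ≤ m s + P / a := add_nonneg (hm0 s) (by positivity)
    gcongr

/-! ### The high modes -/

section Projection

variable (e : HilbertBasis ℕ ℝ H) (N : ℕ)

theorem inner_proj_of_lt {j : ℕ} (hj : j < N) (w : H) :
    inner ℝ (e j) (proj e N w) = inner ℝ (e j) w := by
  have ho := e.orthonormal
  rw [proj, inner_sum]
  simp_rw [real_inner_smul_right, orthonormal_iff_ite.1 ho]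
  simp [hj]

theorem inner_sub_proj {j : ℕ} (hj : j < N) (w : H) :
    inner ℝ (e j) (w - proj e N w) = 0 := by
  rw [inner_sub_right, inner_proj_of_lt e N hj, sub_self]

theorem inner_proj_eq_zero {z : H} (hz : ∀ j < N, inner ℝ (e j) z = 0) (w : H) :
    inner ℝ (proj e N w) z = 0 := by
  rw [proj, sum_inner]
  refine Finset.sum_eq_zero fun j hj => ?_
  rw [real_inner_smul_left, hz j (Finset.mem_range.1 hj), mul_zero]

theorem inner_proj_sub_proj (w w' : H) :
    inner ℝ (proj e N w') (w - proj e N w) = 0 :=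
  inner_proj_eq_zero e N (fun _ hj => inner_sub_proj e N hj w) w'

theorem norm_sq_eq_proj_add (w : H) :
    ‖w‖ ^ 2 = ‖proj e N w‖ ^ 2 + ‖w - proj e N w‖ ^ 2 := by
  have h := norm_add_sq_real (proj e N w) (w - proj e N w)
  rw [inner_proj_sub_proj, add_sub_cancel] at h
  linarith

theorem norm_sub_proj_le (w : H) : ‖w - proj e N w‖ ≤ ‖w‖ := by
  have h := norm_sq_eq_proj_add e N w
  refine le_of_sq_le_sq ?_ (norm_nonneg w)
  nlinarith [sq_nonneg ‖proj e N w‖]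

theorem continuous_proj : Continuous (proj e N) := by
  unfold proj
  fun_prop

variable {e N}

theorem dx_proj (he : ∀ j, MemH1 (e j)) (w : H) :
    dx (proj e N w) = ∑ j ∈ Finset.range N, inner ℝ (e j) w • dx (e j) :=
  (hasWeakDeriv_proj he N w).dx_eq

theorem memH1_proj (he : ∀ j, MemH1 (e j)) (w : H) : MemH1 (proj e N w) :=
  (hasWeakDeriv_proj he N w).memH1

theorem continuous_dx_proj (he : ∀ j, MemH1 (e j)) : Continuous fun w => dx (proj e N w) := by
  simp_rw [dx_proj he]
  fun_prop

theorem feedback_basis {k : ℕ} (hk : k < N) (q : ℝ) (ν α : ℂ) (u v : H) :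
    feedback q ν α e N u v (e k) = pairing q ν α u (e k) - pairing q ν α v (e k) := by
  rw [feedback]
  simp_rw [orthonormal_iff_ite.1 e.orthonormal]
  simp [hk]

theorem feedback_eq_zero {f : H} (hf : ∀ j < N, inner ℝ (e j) f = 0) (q : ℝ) (ν α : ℂ) (u v : H) :
    feedback q ν α e N u v f = 0 := by
  rw [feedback]
  refine Finset.sum_eq_zero fun j hj => ?_
  rw [hf j (Finset.mem_range.1 hj), mul_zero]

end Projection

/-! ### The difference of the two solutions -/

section Difference

variable {a q : ℝ} {ν α : ℂ} {h u₀ v₀ : H} {W U V : ℝ≥0 → H} {e : HilbertBasis ℕ ℝ H} {N : ℕ}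

/-- The noise, the force and the initial values cancel in the equation for `u - v`. -/
theorem inner_difference_eq
    (hU : WeakForm h u₀ W U (fun t f => a * inner ℝ (U t) f + pairing q ν α (U t) f))
    (hV : WeakForm h v₀ W V (fun t f => a * inner ℝ (V t) f + pairing q ν α (V t) f
      + feedback q ν α e N (U t) (V t) f))
    {f : H} (hf : MemH1 f) {s t : ℝ} (hs : 0 ≤ s) (hst : s ≤ t) :
    inner ℝ ((U t.toNNReal - V t.toNNReal) - (U s.toNNReal - V s.toNNReal)) f =
      ∫ r in s..t, -(a * inner ℝ (U r.toNNReal - V r.toNNReal) f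
        + (pairing q ν α (U r.toNNReal) f - pairing q ν α (V r.toNNReal) f)
        - feedback q ν α e N (U r.toNNReal) (V r.toNNReal) f) := by
  have ht := hs.trans hst
  obtain ⟨iUs, eUs⟩ := hU f hf s.toNNReal
  obtain ⟨iUt, eUt⟩ := hU f hf t.toNNReal
  obtain ⟨iVs, eVs⟩ := hV f hf s.toNNReal
  obtain ⟨iVt, eVt⟩ := hV f hf t.toNNReal
  rw [Real.coe_toNNReal _ hs] at iUs eUs iVs eVs
  rw [Real.coe_toNNReal _ ht] at iUt eUt iVt eVt
  have dU := intervalIntegral.integral_interval_sub_left iUt iUs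
  have dV := intervalIntegral.integral_interval_sub_left iVt iVs
  have iU := iUs.symm.trans iUt
  have iV := iVs.symm.trans iVt
  have e1 : ∫ r in s..t, -(a * inner ℝ (U r.toNNReal - V r.toNNReal) f
        + (pairing q ν α (U r.toNNReal) f - pairing q ν α (V r.toNNReal) f)
        - feedback q ν α e N (U r.toNNReal) (V r.toNNReal) f)
      = ∫ r in s..t, ((a * inner ℝ (V r.toNNReal) f + pairing q ν α (V r.toNNReal) f
        + feedback q ν α e N (U r.toNNReal) (V r.toNNReal) f)
        - (a * inner ℝ (U r.toNNReal) f + pairing q ν α (U r.toNNReal) f)) := by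
    refine intervalIntegral.integral_congr fun r _ => ?_
    simp only [inner_sub_left]
    ring
  rw [e1, intervalIntegral.integral_sub iV iU, ← dU, ← dV]
  simp only [inner_sub_left]
  linarith

/-- A continuous function with `c' = -a c` in integrated form decays exponentially. -/
theorem eq_exp_mul_of_integral_eq {c : ℝ → ℝ} (hc : Continuous c)
    (h : ∀ s t : ℝ, 0 ≤ s → s ≤ t → c t - c s = ∫ r in s..t, -(a * c r)) {s t : ℝ} (hs : 0 ≤ s)
    (hst : s ≤ t) : c t = Real.exp (-a * (t - s)) * c s := by
  have hd : ∀ x, s ≤ x → HasDerivWithinAt c (-(a * c x)) (Ici x) x := by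
    intro x hx
    have h1 : HasDerivAt (fun y => c s + ∫ r in s..y, -(a * c r)) (-(a * c x)) x :=
      (((continuous_const.mul hc).neg.integral_hasStrictDerivAt s x).hasDerivAt).const_add (c s)
    refine h1.hasDerivWithinAt.congr (fun y hy => ?_) ?_
    · rw [← h s y hs (hx.trans hy)]; ring
    · rw [← h s x hs hx]; ring
  have hE : ∀ x, HasDerivAt (fun x => Real.exp (a * (x - s))) (Real.exp (a * (x - s)) * a) x := by
    intro x
    have : HasDerivAt (fun x => a * (x - s)) a x := by
      simpa using ((hasDerivAt_id x).sub_const s).const_mul a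
    exact this.exp
  have key := constant_of_has_deriv_right_zero (f := fun x => Real.exp (a * (x - s)) * c x)
    (a := s) (b := t) (by fun_prop) (fun x hx => by
      refine ((hE x).hasDerivWithinAt.mul (hd x hx.1)).congr_deriv ?_
      ring) t ⟨hst, le_rfl⟩
  simp only [sub_self, mul_zero, Real.exp_zero, one_mul] at key
  rw [← key, ← mul_assoc, ← Real.exp_add]
  simp

/-- The pathwise content of the two equations: `U` and `V` are energy paths solving the equation and
the equation with feedback, driven by the same path `W`, for a basis of `H` contained in `H¹`. -/
structure IsCoupledPair (a q : ℝ) (ν α : ℂ) (h u₀ v₀ : H) (W : ℝ≥0 → H) (e : HilbertBasis ℕ ℝ H)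
    (N : ℕ) (U V : ℝ≥0 → H) : Prop where
  path_left : IsEnergyPath U
  path_right : IsEnergyPath V
  weak_left : WeakForm h u₀ W U (fun t f => a * inner ℝ (U t) f + pairing q ν α (U t) f)
  weak_right : WeakForm h v₀ W V (fun t f => a * inner ℝ (V t) f + pairing q ν α (V t) f
    + feedback q ν α e N (U t) (V t) f)
  basis : ∀ j, MemH1 (e j)

theorem IsEnergyPath.continuous_real {U : ℝ≥0 → H} (h : IsEnergyPath U) :
    Continuous fun r : ℝ => U r.toNNReal :=
  h.continuous.comp continuous_real_toNNReal

/-- The low modes of the difference decay like `e^{-at}`. -/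
theorem IsCoupledPair.proj_difference_eq (hp : IsCoupledPair a q ν α h u₀ v₀ W e N U V)
    {s t : ℝ} (hs : 0 ≤ s) (hst : s ≤ t) :
    proj e N (U t.toNNReal - V t.toNNReal) =
      Real.exp (-a * (t - s)) • proj e N (U s.toNNReal - V s.toNNReal) := by
  have hc : ∀ k < N, inner ℝ (e k) (U t.toNNReal - V t.toNNReal)
      = Real.exp (-a * (t - s)) * inner ℝ (e k) (U s.toNNReal - V s.toNNReal) := by
    intro k hk
    refine eq_exp_mul_of_integral_eq
      (c := fun r => inner ℝ (e k) (U r.toNNReal - V r.toNNReal)) ?_ ?_ hs hst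
    · exact continuous_const.inner (hp.path_left.continuous_real.sub hp.path_right.continuous_real)
    · intro s t hs hst
      have h1 := inner_difference_eq hp.weak_left hp.weak_right (hp.basis k) hs hst
      rw [← inner_sub_right, real_inner_comm, h1]
      refine intervalIntegral.integral_congr fun r _ => ?_
      simp only [feedback_basis hk, real_inner_comm (e k)]
      ring
  rw [proj, proj, Finset.smul_sum]
  refine Finset.sum_congr rfl fun k hk => ?_
  rw [hc k (Finset.mem_range.1 hk), mul_smul]

end Difference

/-! ### The energy inequality for the difference -/

section EnergyInequality

theorem memLp_Ioc_of_continuous {E : Type*} [NormedAddCommGroup E] {f : ℝ → E} (hf : Continuous f)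
    [SecondCountableTopologyEither ℝ E] (τ : ℝ) :
    MemLp f 2 (volume.restrict (Ioc 0 τ)) := by
  obtain ⟨C, hC⟩ := isCompact_Icc.exists_bound_of_continuousOn (hf.continuousOn (s := Icc 0 τ))
  refine MemLp.of_bound hf.aestronglyMeasurable C ?_
  filter_upwards [ae_restrict_mem measurableSet_Ioc] with r hr
  exact hC r (Ioc_subset_Icc_self hr)

theorem IsEnergyPath.ae_memH1 {U : ℝ≥0 → H} (h : IsEnergyPath U) (τ : ℝ) :
    ∀ᵐ r ∂(volume.restrict (Ioc 0 τ)), MemH1 (U r.toNNReal) :=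
  ae_restrict_of_ae_restrict_of_subset Ioc_subset_Ioi_self h.memH1

theorem IsEnergyPath.memLp_dx_real {U : ℝ≥0 → H} (h : IsEnergyPath U) (τ : ℝ) :
    MemLp (fun r : ℝ => dx (U r.toNNReal)) 2 (volume.restrict (Ioc 0 τ)) := by
  rcases le_total 0 τ with hτ | hτ
  · have := h.memLp_dx τ.toNNReal
    rwa [Real.coe_toNNReal _ hτ] at this
  · rw [Ioc_eq_empty (not_lt.2 hτ), Measure.restrict_empty]
    exact memLp_measure_zero

theorem IsEnergyPath.memLp_powMul {U : ℝ≥0 → H} (h : IsEnergyPath U) {q : ℝ} (hq₀ : 0 ≤ q)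
    (hq₂ : q ≤ 2) (τ : ℝ) :
    MemLp (fun r : ℝ => powMul q (U r.toNNReal)) 2 (volume.restrict (Ioc 0 τ)) := by
  obtain ⟨B, hB⟩ := isCompact_Icc.exists_bound_of_continuousOn
    (h.continuous_real.continuousOn (s := Icc 0 τ))
  have hc : MemLp (fun _ : ℝ => B + 4 * B ^ 3) 2 (volume.restrict (Ioc 0 τ)) :=
    memLp_const _
  have hd : MemLp (fun r : ℝ => 4 * B ^ 2 * ‖dx (U r.toNNReal)‖) 2 (volume.restrict (Ioc 0 τ)) :=
    (h.memLp_dx_real τ).norm.const_mul _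
  have h1 : MemLp (fun r : ℝ => (B + 4 * B ^ 3) + 4 * B ^ 2 * ‖dx (U r.toNNReal)‖) 2
      (volume.restrict (Ioc 0 τ)) := hc.add hd
  refine h1.of_le (aestronglyMeasurable_powMul hq₀ hq₂ h.continuous_real (h.ae_memH1 τ)) ?_
  filter_upwards [h.ae_memH1 τ, ae_restrict_mem measurableSet_Ioc] with r hr hrτ
  have hBr := hB r (Ioc_subset_Icc_self hrτ)
  have hU0 := norm_nonneg (U r.toNNReal)
  have hB0 : 0 ≤ B := hU0.trans hBr
  have hb : ∀ x y : ℝ, 0 ≤ x → x ≤ B → 0 ≤ y →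
      (1 + 4 * (x * (x + y))) * x ≤ (B + 4 * B ^ 3) + 4 * B ^ 2 * y := by
    intro x y hx hxB hy
    calc (1 + 4 * (x * (x + y))) * x ≤ (1 + 4 * (B * (B + y))) * B := by gcongr
      _ = (B + 4 * B ^ 3) + 4 * B ^ 2 * y := by ring
  exact (hr.norm_powMul_le hq₀ hq₂).trans
    ((hb _ _ hU0 hBr (norm_nonneg _)).trans (Real.le_norm_self _))

theorem inner_smul_self_eq (ν : ℂ) (x : H) : inner ℝ (ν • x) x = ν.re * ‖x‖ ^ 2 := by
  rw [L2.inner_def, norm_sq_eq_integral, ← integral_const_mul]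
  refine integral_congr_ae ?_
  filter_upwards [Lp.coeFn_smul ν x] with y hy
  rw [hy, Pi.smul_apply, smul_eq_mul, Complex.inner, ← Complex.normSq_eq_norm_sq,
    Complex.normSq_apply]
  simp
  ring

variable {a q : ℝ} {ν α : ℂ} {h u₀ v₀ : H} {W U V : ℝ≥0 → H} {e : HilbertBasis ℕ ℝ H} {N : ℕ}

/-- The difference `w = u - v` of two paths, as a function of real time. -/
noncomputable def diff (U V : ℝ≥0 → H) (r : ℝ) : H := U r.toNNReal - V r.toNNReal

/-- The high modes `w - P_N w` of the difference. -/
noncomputable def high (e : HilbertBasis ℕ ℝ H) (N : ℕ) (U V : ℝ≥0 → H) (r : ℝ) : H :=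
  diff U V r - proj e N (diff U V r)

theorem inner_high_of_lt {j : ℕ} (hj : j < N) (r : ℝ) : inner ℝ (e j) (high e N U V r) = 0 :=
  inner_sub_proj e N hj _

/-- The time derivative of `‖w‖²` as given by the two equations. The derivative of the high modes is
written as `∂ₓu - ∂ₓv - ∂ₓP_N w`, which is visibly measurable in time. -/
noncomputable def rate (a q : ℝ) (ν α : ℂ) (e : HilbertBasis ℕ ℝ H) (N : ℕ) (U V : ℝ≥0 → H)
    (r : ℝ) : ℝ :=
  -2 * (inner ℝ (a • diff U V r + (α • powMul q (U r.toNNReal) - α • powMul q (V r.toNNReal)))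
        (high e N U V r)
      + inner ℝ (ν • (dx (U r.toNNReal) - dx (V r.toNNReal)))
        (dx (U r.toNNReal) - dx (V r.toNNReal) - dx (proj e N (diff U V r))))
    - 2 * a * ‖proj e N (diff U V r)‖ ^ 2

theorem IsCoupledPair.continuous_diff (hp : IsCoupledPair a q ν α h u₀ v₀ W e N U V) :
    Continuous (diff U V) :=
  hp.path_left.continuous_real.sub hp.path_right.continuous_real

theorem IsCoupledPair.continuous_high (hp : IsCoupledPair a q ν α h u₀ v₀ W e N U V) :
    Continuous (high e N U V) :=
  hp.continuous_diff.sub ((continuous_proj e N).comp hp.continuous_diff)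

theorem memH1_high {r : ℝ} (he : ∀ j, MemH1 (e j)) (hu : MemH1 (U r.toNNReal))
    (hv : MemH1 (V r.toNNReal)) : MemH1 (high e N U V r) :=
  (hu.sub hv).sub (memH1_proj he _)

theorem dx_high {r : ℝ} (he : ∀ j, MemH1 (e j)) (hu : MemH1 (U r.toNNReal))
    (hv : MemH1 (V r.toNNReal)) : dx (high e N U V r)
      = dx (U r.toNNReal) - dx (V r.toNNReal) - dx (proj e N (diff U V r)) := by
  have := dx_sub (hu.sub hv) (memH1_proj (N := N) he (diff U V r))
  rwa [dx_sub hu hv] at this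

theorem memLp_toLp_prod {μ : Measure ℝ} {A B : ℝ → H} (hA : MemLp A 2 μ) (hB : MemLp B 2 μ) :
    MemLp (fun r => WithLp.toLp 2 (A r, B r)) 2 μ := by
  have h1 := ((WithLp.prodContinuousLinearEquiv 2 ℝ H H).symm.toContinuousLinearMap.comp
    (ContinuousLinearMap.inl ℝ H H)).comp_memLp' hA
  have h2 := ((WithLp.prodContinuousLinearEquiv 2 ℝ H H).symm.toContinuousLinearMap.comp
    (ContinuousLinearMap.inr ℝ H H)).comp_memLp' hB
  refine (h1.add h2).congr_norm ?_ ?_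
  · refine (h1.add h2).aestronglyMeasurable.congr (Eventually.of_forall fun r => ?_)
    simp [← WithLp.toLp_add]
  · refine Eventually.of_forall fun r => ?_
    simp [← WithLp.toLp_add]

/-- The energy identity for the difference, with its integrability. -/
theorem IsCoupledPair.norm_sq_diff (hp : IsCoupledPair a q ν α h u₀ v₀ W e N U V)
    (hq₀ : 0 ≤ q) (hq₂ : q ≤ 2) {s t : ℝ} (hs : 0 ≤ s) (hst : s ≤ t) :
    IntervalIntegrable (rate a q ν α e N U V) volume s t ∧
      ‖diff U V t‖ ^ 2 = ‖diff U V s‖ ^ 2 + ∫ r in s..t, rate a q ν α e N U V r := by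
  set A : ℝ → H := fun r =>
    -(a • diff U V r + (α • powMul q (U r.toNNReal) - α • powMul q (V r.toNNReal))) with hA
  set B : ℝ → H := fun r => -(ν • (dx (U r.toNNReal) - dx (V r.toNNReal))) with hB
  set D : ℝ → H := fun r =>
    dx (U r.toNNReal) - dx (V r.toNNReal) - dx (proj e N (diff U V r)) with hD
  have mA : ∀ τ : ℝ, MemLp A 2 (volume.restrict (Ioc 0 τ)) := fun τ =>
    ((memLp_Ioc_of_continuous (hp.continuous_diff.const_smul a) τ).add
      (((hp.path_left.memLp_powMul hq₀ hq₂ τ).const_smul α).sub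
        ((hp.path_right.memLp_powMul hq₀ hq₂ τ).const_smul α))).neg
  have mB : ∀ τ : ℝ, MemLp B 2 (volume.restrict (Ioc 0 τ)) := fun τ =>
    (((hp.path_left.memLp_dx_real τ).sub (hp.path_right.memLp_dx_real τ)).const_smul ν).neg
  have mD : ∀ τ : ℝ, MemLp D 2 (volume.restrict (Ioc 0 τ)) := fun τ =>
    ((hp.path_left.memLp_dx_real τ).sub (hp.path_right.memLp_dx_real τ)).sub
      (memLp_Ioc_of_continuous ((continuous_dx_proj hp.basis).comp hp.continuous_diff) τ)
  set G : ℝ → WithLp 2 (H × H) := fun r => WithLp.toLp 2 (A r, B r) with hG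
  set X : ℝ → WithLp 2 (H × H) := fun r => WithLp.toLp 2 (high e N U V r, D r) with hX
  have mG : ∀ τ : ℝ, MemLp G 2 (volume.restrict (Ioc 0 τ)) := fun τ =>
    memLp_toLp_prod (mA τ) (mB τ)
  have mX : ∀ τ : ℝ, MemLp X 2 (volume.restrict (Ioc 0 τ)) := fun τ =>
    memLp_toLp_prod (memLp_Ioc_of_continuous hp.continuous_high τ) (mD τ)
  have hweak : ∀ᵐ r ∂(volume.restrict (Ioi (0 : ℝ))), ∀ s t : ℝ, 0 ≤ s → s ≤ t →
      inner ℝ (high e N U V t - high e N U V s) (high e N U V r)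
        = ∫ ρ in s..t, inner ℝ (G ρ) (X r) := by
    filter_upwards [hp.path_left.memH1, hp.path_right.memH1] with r hur hvr s t hs hst
    have hz := memH1_high (N := N) hp.basis hur hvr
    have horth : ∀ j < N, inner ℝ (e j) (high e N U V r) = 0 := fun j hj => inner_high_of_lt hj r
    have e1 : inner ℝ (high e N U V t - high e N U V s) (high e N U V r)
        = inner ℝ (diff U V t - diff U V s) (high e N U V r) := by
      have h1 := inner_proj_eq_zero e N horth (diff U V t)
      have h2 := inner_proj_eq_zero e N horth (diff U V s)
      rw [show high e N U V t = diff U V t - proj e N (diff U V t) from rfl,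
        show high e N U V s = diff U V s - proj e N (diff U V s) from rfl]
      simp only [inner_sub_left, h1, h2, sub_zero]
    rw [e1, diff, diff, inner_difference_eq hp.weak_left hp.weak_right hz hs hst]
    refine intervalIntegral.integral_congr_ae ?_
    have hmem : ∀ {Y : ℝ≥0 → H}, IsEnergyPath Y → ∀ᵐ ρ : ℝ,
        ρ ∈ uIoc s t → MemH1 (Y ρ.toNNReal) := by
      intro Y hY
      filter_upwards [(ae_restrict_iff' measurableSet_Ioi).1 hY.memH1] with ρ hρ hρst
      rw [uIoc_of_le hst] at hρst
      exact hρ (hs.trans_lt hρst.1)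
    filter_upwards [hmem hp.path_left, hmem hp.path_right] with ρ hu hv hρ
    rw [feedback_eq_zero horth, (hu hρ).pairing_eq hq₀, (hv hρ).pairing_eq hq₀,
      dx_high hp.basis hur hvr]
    simp only [hG, hX, hA, hB, hD, WithLp.prod_inner_apply, inner_neg_left, inner_add_left,
      inner_sub_left, smul_sub, real_inner_smul_left, diff]
    ring
  have hen := norm_sq_sub_norm_sq_eq hp.continuous_high mG mX hweak hs hst
  have hGX : IntervalIntegrable (fun r => inner ℝ (G r) (X r)) volume s t := by
    rw [intervalIntegrable_iff_integrableOn_Ioc_of_le hst]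
    have : Integrable (fun r => inner ℝ (G r) (X r)) (volume.restrict (Ioc 0 t)) := by
      refine Integrable.mono' (((memLp_two_iff_integrable_sq_norm (mG t).1).1 (mG t)).add
        ((memLp_two_iff_integrable_sq_norm (mX t).1).1 (mX t))) ((mG t).1.inner (mX t).1) ?_
      refine Eventually.of_forall fun r => (norm_inner_le_norm _ _).trans ?_
      simp only [Pi.add_apply]
      nlinarith [sq_nonneg (‖G r‖ - ‖X r‖), sq_nonneg ‖G r‖, sq_nonneg ‖X r‖]
    exact this.mono_measure (Measure.restrict_mono (Ioc_subset_Ioc_left hs) le_rfl)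
  have hrate : rate a q ν α e N U V = fun r =>
      2 * inner ℝ (G r) (X r) - 2 * a * ‖proj e N (diff U V r)‖ ^ 2 := by
    funext r
    simp only [rate, hG, hX, hA, hB, hD, WithLp.prod_inner_apply, inner_neg_left]
    ring
  have hP : Continuous fun r => 2 * a * ‖proj e N (diff U V r)‖ ^ 2 :=
    continuous_const.mul (((continuous_proj e N).comp hp.continuous_diff).norm.pow 2)
  have hlow : ‖proj e N (diff U V t)‖ ^ 2 - ‖proj e N (diff U V s)‖ ^ 2
      = -∫ r in s..t, 2 * a * ‖proj e N (diff U V r)‖ ^ 2 := by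
    have hdec : ∀ r, s ≤ r → ‖proj e N (diff U V r)‖ ^ 2
        = Real.exp (-2 * a * (r - s)) * ‖proj e N (diff U V s)‖ ^ 2 := by
      intro r hr
      rw [diff, diff, hp.proj_difference_eq hs hr, norm_smul, mul_pow, Real.norm_eq_abs, sq_abs,
        ← Real.exp_nat_mul]
      congr 2
      push_cast; ring
    have hder : ∀ r : ℝ, HasDerivAt (fun r => Real.exp (-2 * a * (r - s)) *
        ‖proj e N (diff U V s)‖ ^ 2) (Real.exp (-2 * a * (r - s)) * (-2 * a) *
        ‖proj e N (diff U V s)‖ ^ 2) r := by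
      intro r
      have : HasDerivAt (fun r => -2 * a * (r - s)) (-2 * a) r := by
        simpa using ((hasDerivAt_id r).sub_const s).const_mul (-2 * a)
      exact this.exp.mul_const _
    have hftc := intervalIntegral.integral_eq_sub_of_hasDerivAt (a := s) (b := t)
      (fun r _ => hder r) (Continuous.intervalIntegrable (by fun_prop) _ _)
    rw [sub_self, mul_zero, Real.exp_zero, one_mul] at hftc
    rw [hdec t hst, ← hftc, ← intervalIntegral.integral_neg]
    refine intervalIntegral.integral_congr fun r hr => ?_
    rw [uIcc_of_le hst] at hr
    change _ = -(2 * a * ‖proj e N (diff U V r)‖ ^ 2)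
    rw [hdec r hr.1]
    ring
  have i2 := hP.intervalIntegrable (μ := volume) s t
  refine ⟨by rw [hrate]; exact (hGX.const_mul 2).sub i2, ?_⟩
  rw [hrate, intervalIntegral.integral_sub (hGX.const_mul 2) i2,
    intervalIntegral.integral_const_mul,
    norm_sq_eq_proj_add e N (diff U V t), norm_sq_eq_proj_add e N (diff U V s)]
  simp only [high] at hen
  linarith

/-- The dissipation bounds the rate of change of `‖w‖²`, up to the nonlinear term: half of
`2 ν₁ ‖∂ₓz‖²` is spent, by Young's inequality, on the term `2 ⟨ν ∂ₓP_N w, ∂ₓz⟩`. -/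
theorem rate_le (hν : 0 < ν.re) {r : ℝ} (he : ∀ j, MemH1 (e j)) (hu : MemH1 (U r.toNNReal))
    (hv : MemH1 (V r.toNNReal)) :
    rate a q ν α e N U V r ≤ -2 * a * ‖diff U V r‖ ^ 2
      + 2 * |inner ℝ (α • powMul q (U r.toNNReal) - α • powMul q (V r.toNNReal)) (high e N U V r)|
      - ν.re * ‖dx (high e N U V r)‖ ^ 2
      + ‖ν‖ ^ 2 / ν.re * ‖dx (proj e N (diff U V r))‖ ^ 2 := by
  have hdz := dx_high (N := N) he hu hv
  set z := high e N U V r with hz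
  set p := proj e N (diff U V r) with hpdef
  set g := α • powMul q (U r.toNNReal) - α • powMul q (V r.toNNReal) with hg
  have hsum : dx (U r.toNNReal) - dx (V r.toNNReal) = dx z + dx p := by rw [hdz]; abel
  have hwz : inner ℝ (diff U V r) z = ‖z‖ ^ 2 := by
    have h1 : diff U V r = p + z := by rw [hz, high]; abel
    have h2 : inner ℝ p z = 0 := inner_proj_sub_proj e N _ _
    conv_lhs => rw [h1]
    rw [inner_add_left, h2, zero_add, real_inner_self_eq_norm_sq]
  have hnorm : ‖diff U V r‖ ^ 2 = ‖p‖ ^ 2 + ‖z‖ ^ 2 := norm_sq_eq_proj_add e N _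
  have hcross : -(2 * inner ℝ (ν • dx p) (dx z))
      ≤ ν.re * ‖dx z‖ ^ 2 + ‖ν‖ ^ 2 / ν.re * ‖dx p‖ ^ 2 := by
    have h1 : -inner ℝ (ν • dx p) (dx z) ≤ ‖ν‖ * ‖dx p‖ * ‖dx z‖ := by
      refine (neg_le_abs _).trans ((abs_real_inner_le_norm _ _).trans ?_)
      rw [norm_smul]
    have h2 : ν.re * ‖dx z‖ ^ 2 + ‖ν‖ ^ 2 / ν.re * ‖dx p‖ ^ 2 - 2 * (‖ν‖ * ‖dx p‖ * ‖dx z‖)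
        = (ν.re * ‖dx z‖ - ‖ν‖ * ‖dx p‖) ^ 2 / ν.re := by field_simp; ring
    have h3 : 0 ≤ (ν.re * ‖dx z‖ - ‖ν‖ * ‖dx p‖) ^ 2 / ν.re := by positivity
    linarith
  have habs := neg_abs_le (inner ℝ g z)
  rw [rate, ← hdz, ← hz, ← hpdef, ← hg, hsum, smul_add, inner_add_left, inner_add_left,
    inner_smul_self_eq, real_inner_smul_left, hwz, hnorm]
  linarith

end EnergyInequality

/-! ### The weighted energy and the pathwise estimate -/

theorem MemH1.h1NormSq_eq {f : H} (h : MemH1 f) :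
    h1NormSq f = ENNReal.ofReal (‖f‖ ^ 2 + ‖dx f‖ ^ 2) := by
  rw [h1NormSq, if_pos h, ENNReal.ofReal_add (by positivity) (by positivity),
    ENNReal.ofReal_pow (norm_nonneg _), ENNReal.ofReal_pow (norm_nonneg _), ofReal_norm,
    ofReal_norm]

theorem energy_nonneg (t : ℝ≥0) (f : H) : 0 ≤ energy t f := by unfold energy; positivity

theorem weightedEnergy_eq {U V : ℝ≥0 → H} {r : ℝ≥0} (hu : MemH1 (U r)) (hv : MemH1 (V r)) :
    weightedEnergy U V r = ENNReal.ofReal (energy r (U r) + energy r (V r)) := by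
  rw [weightedEnergy, hu.h1NormSq_eq, hv.h1NormSq_eq, (hu.psiMul r).h1NormSq_eq,
    (hv.psiMul r).h1NormSq_eq, ← ENNReal.ofReal_add (by positivity) (by positivity),
    ← ENNReal.ofReal_add (by positivity) (by positivity),
    ← ENNReal.ofReal_add (by positivity) (by positivity), energy, energy, add_assoc (_ + _ : ℝ)]

theorem MemH1.energy_le {f : H} (h : MemH1 f) {r t : ℝ≥0} (hrt : r ≤ t) :
    energy r f ≤ (3 + 2 * (t : ℝ) ^ 2) * (‖f‖ ^ 2 + ‖dx f‖ ^ 2) := by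
  have hrt' : (r : ℝ) ≤ t := hrt
  have hr0 : (0 : ℝ) ≤ r := r.2
  have h1 : ‖CGL.psiMul r f‖ ^ 2 ≤ (r * ‖f‖) ^ 2 :=
    pow_le_pow_left₀ (norm_nonneg _) (norm_psiMul_le r f) 2
  have h2 : ‖dx (CGL.psiMul r f)‖ ^ 2 ≤ (r * ‖dx f‖ + ‖f‖) ^ 2 :=
    pow_le_pow_left₀ (norm_nonneg _) (h.norm_dx_psiMul_le r) 2
  have h3 : (r : ℝ) ^ 2 ≤ (t : ℝ) ^ 2 := pow_le_pow_left₀ hr0 hrt' 2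
  have h4 : (r : ℝ) ^ 2 * ‖f‖ ^ 2 ≤ (t : ℝ) ^ 2 * ‖f‖ ^ 2 := by gcongr
  have h5 : (r : ℝ) ^ 2 * ‖dx f‖ ^ 2 ≤ (t : ℝ) ^ 2 * ‖dx f‖ ^ 2 := by gcongr
  have h6 : 0 ≤ (t : ℝ) ^ 2 * ‖f‖ ^ 2 := by positivity
  have h7 := two_mul_le_add_sq (r * ‖dx f‖) ‖f‖
  have h8 := sq_nonneg ‖dx f‖
  rw [energy]
  linarith

/-- Along energy paths the weighted energy is locally integrable in time. -/
theorem weightedIntegral_lt_top {U V : ℝ≥0 → H} (hU : IsEnergyPath U) (hV : IsEnergyPath V)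
    (s t : ℝ≥0) : weightedIntegral U V s t < ⊤ := by
  have hsub : Ioc (s : ℝ) t ⊆ Ioc 0 t := Ioc_subset_Ioc_left s.2
  have hI : ∀ {Y : ℝ≥0 → H}, IsEnergyPath Y →
      IntegrableOn (fun r : ℝ => ‖Y r.toNNReal‖ ^ 2 + ‖dx (Y r.toNNReal)‖ ^ 2) (Ioc 0 t) := by
    intro Y hY
    have h1 := memLp_Ioc_of_continuous hY.continuous_real t
    have h2 := hY.memLp_dx_real t
    exact ((memLp_two_iff_integrable_sq_norm h1.1).1 h1).add
      ((memLp_two_iff_integrable_sq_norm h2.1).1 h2)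
  have hI2 := (((hI hU).add (hI hV)).const_mul (3 + 2 * (t : ℝ) ^ 2)).mono_measure
    (Measure.restrict_mono hsub le_rfl)
  refine lt_of_le_of_lt ?_ hI2.lintegral_lt_top
  refine lintegral_mono_ae ?_
  filter_upwards [ae_restrict_of_ae_restrict_of_subset hsub (hU.ae_memH1 t),
    ae_restrict_of_ae_restrict_of_subset hsub (hV.ae_memH1 t),
    ae_restrict_mem measurableSet_Ioc] with r hu hv hr
  rw [weightedEnergy_eq hu hv]
  refine ENNReal.ofReal_le_ofReal ?_
  have hrt : r.toNNReal ≤ t := Real.toNNReal_le_iff_le_coe.2 hr.2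
  have h1 := hu.energy_le hrt
  have h2 := hv.energy_le hrt
  simp only [Pi.add_apply]
  linarith

variable {a q : ℝ} {ν α : ℂ} {h u₀ v₀ : H} {W U V : ℝ≥0 → H} {e : HilbertBasis ℕ ℝ H} {N : ℕ}

/-- The squeezing estimate along one pair of paths, given the bound on the nonlinear term. -/
theorem IsCoupledPair.norm_sq_le (hp : IsCoupledPair a q ν α h u₀ v₀ W e N U V) (ha : 0 < a)
    (hq₀ : 0 ≤ q) (hq₂ : q ≤ 2) (hν : 0 < ν.re) {c : ℝ} (hc : 0 ≤ c) {T : ℝ≥0}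
    (hbound : ∀ t : ℝ≥0, T ≤ t → ∀ u v z : H,
      MemH1 u → MemH1 v → MemH1 z → (∀ j < N, inner ℝ (e j) z = 0) → ‖z‖ ≤ ‖u - v‖ →
      2 * |inner ℝ (α • powMul q u - α • powMul q v) z| ≤
        ν.re * ‖dx z‖ ^ 2 + (a + c * (energy t u + energy t v)) * ‖u - v‖ ^ 2)
    {s t : ℝ≥0} (hTs : T ≤ s) (hst : s ≤ t) :
    ‖U t - V t‖ ^ 2 ≤
      (‖U s - V s‖ ^ 2 + ‖ν‖ ^ 2 / (a * ν.re) * ‖dx (proj e N (U s - V s))‖ ^ 2)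
        * Real.exp (-a * (t - s) + c * (weightedIntegral U V s t).toReal) := by
  have hs0 : (0 : ℝ) ≤ s := s.2
  have hst' : (s : ℝ) ≤ t := hst
  have hdiff : ∀ r : ℝ≥0, diff U V r = U r - V r := fun r => by rw [diff, Real.toNNReal_coe]
  set P : ℝ := ‖ν‖ ^ 2 / ν.re * ‖dx (proj e N (diff U V s))‖ ^ 2 with hP
  have hP0 : 0 ≤ P := by positivity
  set κ : ℝ → ℝ≥0∞ := fun r => ENNReal.ofReal c * weightedEnergy U V r.toNNReal with hκ
  have hκint : ∫⁻ r in Ioc (s : ℝ) t, κ r = ENNReal.ofReal c * weightedIntegral U V s t :=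
    lintegral_const_mul' _ _ ENNReal.ofReal_ne_top
  have hκtop : ∫⁻ r in Ioc (s : ℝ) t, κ r ≠ ⊤ := by
    rw [hκint]
    exact ENNReal.mul_ne_top ENNReal.ofReal_ne_top
      (weightedIntegral_lt_top hp.path_left hp.path_right s t).ne
  have hid := fun x (hx : x ∈ Icc (s : ℝ) t) => (hp.norm_sq_diff hq₀ hq₂ hs0 hx.1).2
  have hle : ∀ᵐ r : ℝ, r ∈ Ioc (s : ℝ) t → rate a q ν α e N U V r ≤
      -a * ‖diff U V r‖ ^ 2 + (κ r).toReal * ‖diff U V r‖ ^ 2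
        + P * Real.exp (-2 * a * (r - s)) := by
    filter_upwards [(ae_restrict_iff' measurableSet_Ioi).1 hp.path_left.memH1,
      (ae_restrict_iff' measurableSet_Ioi).1 hp.path_right.memH1] with r hu hv hr
    have hu := hu (hs0.trans_lt hr.1)
    have hv := hv (hs0.trans_lt hr.1)
    have hTr : T ≤ r.toNNReal := hTs.trans (NNReal.le_toNNReal_of_coe_le hr.1.le)
    have hz := memH1_high (N := N) hp.basis hu hv
    have h1 := rate_le (a := a) (q := q) (α := α) (N := N) hν hp.basis hu hv
    have h2 := hbound r.toNNReal hTr (U r.toNNReal) (V r.toNNReal) (high e N U V r) hu hv hz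
      (fun j hj => inner_high_of_lt hj r) (norm_sub_proj_le e N _)
    have h3 : (κ r).toReal = c * (energy r.toNNReal (U r.toNNReal)
        + energy r.toNNReal (V r.toNNReal)) := by
      simp only [hκ]
      rw [weightedEnergy_eq hu hv, ENNReal.toReal_mul, ENNReal.toReal_ofReal hc,
        ENNReal.toReal_ofReal (add_nonneg (energy_nonneg _ _) (energy_nonneg _ _))]
    have h4 : ‖dx (proj e N (diff U V r))‖ ^ 2
        = Real.exp (-2 * a * (r - s)) * ‖dx (proj e N (diff U V s))‖ ^ 2 := by
      have h5 : proj e N (diff U V r) = Real.exp (-a * (r - s)) • proj e N (diff U V s) :=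
        hp.proj_difference_eq hs0 hr.1.le
      rw [h5, dx_smul (memH1_proj hp.basis _), norm_smul, mul_pow, Real.norm_eq_abs, sq_abs,
        ← Real.exp_nat_mul]
      congr 2
      push_cast; ring
    have h6 : ‖ν‖ ^ 2 / ν.re * ‖dx (proj e N (diff U V r))‖ ^ 2
        = P * Real.exp (-2 * a * (r - s)) := by rw [h4, hP]; ring
    rw [h3]
    rw [h6] at h1
    change 2 * |_| ≤ _ + _ * ‖diff U V r‖ ^ 2 at h2
    linarith
  have key := gronwall_of_lintegral (m := fun r => ‖diff U V r‖ ^ 2) (κ := κ) ha hP0 hst'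
    (hp.continuous_diff.norm.pow 2) (fun _ => by positivity)
    (hp.norm_sq_diff hq₀ hq₂ hs0 hst').1 hκtop hid hle
  rw [hκint, ENNReal.toReal_mul, ENNReal.toReal_ofReal hc] at key
  have hPa : P / a = ‖ν‖ ^ 2 / (a * ν.re) * ‖dx (proj e N (diff U V s))‖ ^ 2 := by
    rw [hP]; field_simp
  rw [hPa] at key
  simpa only [hdiff] using key

end CGL

theorem proposition1 (a q : ℝ) (ν α : ℂ) (ha : 0 < a) (hq₀ : 0 < q) (hq₂ : q < 2)
    (hν : 0 < ν.re) (hα : 0 ≤ α.re) :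
    ∃ C : ℝ, 0 < C ∧
      ∀ e : HilbertBasis ℕ ℝ CGL.H, (∀ j, CGL.MemH1 (e j)) →
      ∀ ε : ℝ, 0 < ε →
      ∃ (T : ℝ≥0) (N : ℕ), 0 < T ∧ 1 ≤ N ∧
        ∀ (h : CGL.H) (b : ℕ → ℝ), Summable (fun j => b j ^ 2) →
        ∀ {Ω : Type*} [mΩ : MeasurableSpace Ω] (P : Measure Ω) [IsProbabilityMeasure P]
          (𝓕 : Filtration ℝ≥0 mΩ) (β : ℕ → ℝ≥0 → Ω → ℝ),
        CGL.UsualConditions P 𝓕 → CGL.IsBrownianFamily P 𝓕 β →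
        ∀ (u₀ u₀' : CGL.H) (u v : ℝ≥0 → Ω → CGL.H),
        CGL.IsCGLSolution P 𝓕 a q ν α h (CGL.noise b e β) u₀ u →
        CGL.IsFeedbackSolution P 𝓕 a q ν α h (CGL.noise b e β) e N u u₀' v →
        ∀ᵐ ω ∂P, ∀ s t : ℝ≥0, s ≤ t →
          CGL.weightedIntegral (fun r => u r ω) (fun r => v r ω) (s + T) (t + T) < ⊤ ∧
          ‖u (t + T) ω - v (t + T) ω‖ ^ 2 ≤
            (‖u (s + T) ω - v (s + T) ω‖ ^ 2
              + ‖ν‖ ^ 2 / (a * ν.re)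
                * ‖CGL.dx (CGL.proj e N (u (s + T) ω - v (s + T) ω))‖ ^ 2)
            * Real.exp (-a * (t - s) + C * ε *
                (CGL.weightedIntegral (fun r => u r ω) (fun r => v r ω) (s + T) (t + T)).toReal) := by
  refine ⟨6 * ‖α‖ + 1, by positivity, fun e he ε hε => ?_⟩
  obtain ⟨T, N, hT, hN, hbound⟩ := CGL.exists_nonlinear_bound ha hq₀ hq₂ hν α e hε
  refine ⟨T, N, hT, hN, ?_⟩
  intro h b _ Ω mΩ P _ 𝓕 β _ _ u₀ u₀' u v hu hv
  filter_upwards [hu.path, hu.weak, hv.path, hv.weak] with ω pu wu pv wv s t hst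
  refine ⟨CGL.weightedIntegral_lt_top pu pv _ _, ?_⟩
  have hp : CGL.IsCoupledPair a q ν α h u₀ u₀' (fun t => CGL.noise b e β t ω) e N
      (fun t => u t ω) (fun t => v t ω) := ⟨pu, pv, wu, wv, he⟩
  have key := hp.norm_sq_le (c := (6 * ‖α‖ + 1) * ε) ha hq₀.le hq₂.le hν (by positivity) hbound
    (s := s + T) (t := t + T) le_add_self (add_le_add_left hst T)
  have e1 : ((t + T : ℝ≥0) : ℝ) - ((s + T : ℝ≥0) : ℝ) = t - s := by push_cast; ring
  rwa [e1] at key
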